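/- Let $r,s,t,u$ be integers with $ru-st=\pm1$ and $rstu\neq 0$, and let $G$ be the fundamental group of the sapphire (torus semi-bundle) $K(r,s,t,u)$, that is, the group with presentation $$G=\langle a_1,b_1,a_2 \mid a_1b_1a_1^{-1}=b_1^{-1},\ a_2^2=a_1^{2r}b_1^{s},\ a_2a_1^{2t}b_1^{u}a_2^{-1}=b_1^{-u}a_1^{-2t}\rangle .$$ Then the cohomology groups of $G$ with coefficients in the trivial $G$-module $\mathbb{Z}$ are, up to isomorphism of abelian groups, $$H^0(G;\mathbb{Z})\cong\mathbb{Z},\qquad H^1(G;\mathbb{Z})=0,\qquad H^2(G;\mathbb{Z})\cong\begin{cases}\mathbb{Z}_{4|t|}\oplus\mathbb{Z}_2\oplus\mathbb{Z}_2,&\text{if } s \text{ is even},\\ \mathbb{Z}_{4|t|}\oplus\mathbb{Z}_4,&\text{if } s\text{ is odd},\end{cases}\qquad H^3(G;\mathbb{Z})\cong\mathbb{Z},$$ and $H^n(G;\mathbb{Z})=0$ for all $n\ge 4$, where $\mathbb{Z}_m=\mathbb{Z}/m\mathbb{Z}$. -/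

import Mathlib

/-- Names of the three generators of the fundamental group of a sapphire. -/
inductive SapphireGen : Type
  | a₁
  | b₁
  | a₂

namespace Sapphire

/-- A free generator. -/
def a₁ : FreeGroup SapphireGen := FreeGroup.of SapphireGen.a₁

/-- A free generator. -/
def b₁ : FreeGroup SapphireGen := FreeGroup.of SapphireGen.b₁

/-- A free generator. -/
def a₂ : FreeGroup SapphireGen := FreeGroup.of SapphireGen.a₂

/-- The relators of the presentation: an equation `p = q` is encoded as the relator `p * q⁻¹`. -/
def relators (r s t u : ℤ) : Set (FreeGroup SapphireGen) :=
  { (a₁ * b₁ * a₁⁻¹) * (b₁⁻¹)⁻¹,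
    (a₂ ^ 2) * (a₁ ^ (2 * r) * b₁ ^ s)⁻¹,
    (a₂ * a₁ ^ (2 * t) * b₁ ^ u * a₂⁻¹) * (b₁ ^ (-u) * a₁ ^ (-(2 * t)))⁻¹ }

end Sapphire

/-- The fundamental group of the sapphire `K(r, s, t, u)`, given by its presentation
`⟨a₁, b₁, a₂ ∣ a₁ b₁ a₁⁻¹ = b₁⁻¹, a₂² = a₁^{2r} b₁^s, a₂ a₁^{2t} b₁^u a₂⁻¹ = b₁^{-u} a₁^{-2t}⟩`. -/
abbrev SapphireGroup (r s t u : ℤ) : Type :=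
  PresentedGroup (Sapphire.relators r s t u)

/-- `Hⁿ(G; ℤ)` for `G` the group of the sapphire `K(r, s, t, u)`, acting trivially on `ℤ`. -/
noncomputable abbrev SapphireCohomology (r s t u : ℤ) (n : ℕ) : ModuleCat ℤ :=
  groupCohomology (Rep.trivial ℤ (SapphireGroup r s t u) ℤ) n

/-!
The cohomology is computed from an explicit free resolution of `ℤ` over the group ring `ℤ[G]`,
with modules of row vectors of ranks `1, 3, 3, 1`. Its differentials are right multiplications by
matrices: the column of the elements `g - 1` for the generators `g` (`bd₁`), the Fox matrix of the
presentation (`bd₂`), and a single row (`bd₃`). Geometrically this is a cell structure on the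
universal cover of the sapphire, which is contractible; algebraically, exactness rests on three
facts.

* If `v` has infinite order, `v - 1` is not a right zero divisor, and if moreover `u` commutes with
  `v` and no positive power of `u` lies in `⟨v⟩`, then `u - 1` is not a right zero divisor modulo
  the left ideal of `v - 1` (`MonoidAlgebra.exists_eq_mul_of_mul_of_sub_one_eq`). Both hold because
  a finitely supported function invariant under an injective map without periodic points vanishes.
  They give exactness for a Klein bottle group `⟨x, y ∣ y x y = x⟩`
  (`exists_eq_mul_of_klein_cycle`, `exists_eq_mul_of_klein_syzygy`).
* The torus elements `a₁²` and `b₁` generate a free abelian group of rank two, because `G` acts on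
  the lattice `ℤ × ℤ` by affine maps with these elements acting as independent translations
  (`SapphireGroup.affineAction`). By unimodularity of `(r, s; t, u)`, the same subgroup is generated
  by `a₂²` and `z = a₁ ^ (2 * t) * b₁ ^ u`; it is normal.
* Modulo this subgroup, `a₁` and `a₂` are involutions whose product has infinite order, which is
  seen in the infinite dihedral group. Hence a cycle of degree one can be freed of its
  `a₂`-coordinate using the two relations that involve `a₂`
  (`SapphireGroup.exists_eq_of_tree_cycle`).

With the `a₂`-coordinate removed, a one-cycle is a cycle for the first Klein bottle group. In degree
two, the `a₂`-coordinate of the differential sees only the second Klein bottle group, whose syzygies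
are free of rank one; the remaining coordinate of the generator exists by exactness in degree one
and is unique. Its augmentation vanishes since it is annihilated by `2`.

For trivial coefficients the cochain complex is therefore `ℤ → ℤ³ → ℤ³ → ℤ` with first and last map
zero and the middle one the augmented Fox matrix, injective as `t ≠ 0`. Its cokernel is the second
cohomology, and depends on the parity of `s`.
-/

/-! ### Cohomology from a matrix resolution -/

section Resolution

open CategoryTheory

universe v

variable {k G : Type v} [CommRing k] [Group G]

/-- The augmentation `k[G] → k`, sending every group element to `1`. -/
noncomputable def augmentation (k G : Type*) [CommRing k] [Group G] : MonoidAlgebra k G →ₐ[k] k :=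
  MonoidAlgebra.lift k k G 1

@[simp]
lemma augmentation_single {k G : Type*} [CommRing k] [Group G] (g : G) (x : k) :
    augmentation k G (MonoidAlgebra.single g x) = x := by
  simp [augmentation]

/-- The action of `G` on row vectors over `k[G]` by left multiplication on each entry. -/
noncomputable def rowRepresentation (k G : Type*) [CommRing k] [Group G] (n : ℕ) :
    Representation k G (Fin n → MonoidAlgebra k G) where
  toFun g := (LinearMap.mulLeft k (MonoidAlgebra.of k G g)).compLeft (Fin n)
  map_one' := LinearMap.ext fun v => by
    change MonoidAlgebra.of k G 1 • v = v
    rw [map_one, one_smul]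
  map_mul' g h := LinearMap.ext fun v => by
    change MonoidAlgebra.of k G (g * h) • v = MonoidAlgebra.of k G g • MonoidAlgebra.of k G h • v
    rw [map_mul, mul_smul]

lemma rowRepresentation_apply (n : ℕ) (g : G) (v : Fin n → MonoidAlgebra k G) :
    rowRepresentation k G n g v = MonoidAlgebra.of k G g • v := rfl

/-- The free representation `k[G]ⁿ`, seen as row vectors. -/
noncomputable abbrev rowRep (k G : Type v) [CommRing k] [Group G] (n : ℕ) : Rep.{v} k G :=
  Rep.of (rowRepresentation k G n)

/-- The morphism out of `k[G]ⁿ` with prescribed values on the standard basis. -/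
noncomputable def rowLift {n : ℕ} (A : Rep.{v} k G) (x : Fin n → A) : rowRep k G n ⟶ A :=
  Rep.ofHom (σ := A.ρ)
    { toLinearMap := ∑ i, LinearMap.applyₗ (x i) ∘ₗ A.ρ.asAlgebraHom.toLinearMap ∘ₗ
        LinearMap.proj i
      isIntertwining' := fun g => by
        ext v
        simp [rowRepresentation_apply] }

lemma rowLift_apply {n : ℕ} (A : Rep.{v} k G) (x : Fin n → A) (v : Fin n → MonoidAlgebra k G) :
    (rowLift A x).hom v = ∑ i, A.ρ.asAlgebraHom (v i) (x i) := by
  change (∑ i, LinearMap.applyₗ (x i) ∘ₗ A.ρ.asAlgebraHom.toLinearMap ∘ₗ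
        LinearMap.proj i : (Fin n → MonoidAlgebra k G) →ₗ[k] A) v = _
  simp

lemma asAlgebraHom_hom {A B : Rep.{v} k G} (f : A ⟶ B) (x : MonoidAlgebra k G) (a : A) :
    f.hom (A.ρ.asAlgebraHom x a) = B.ρ.asAlgebraHom x (f.hom a) := by
  induction x using MonoidAlgebra.induction_linear with
  | zero => simp
  | add x y hx hy => simp [hx, hy]
  | single g r => simp [Rep.hom_comm_apply]

lemma asAlgebraHom_rowRepresentation {n : ℕ} (x : MonoidAlgebra k G)
    (v : Fin n → MonoidAlgebra k G) :
    (rowRepresentation k G n).asAlgebraHom x v = x • v := by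
  induction x using MonoidAlgebra.induction_linear with
  | zero => simp
  | add x y hx hy => simp [hx, hy, add_smul]
  | single g r =>
    rw [Representation.asAlgebraHom_single, LinearMap.smul_apply, rowRepresentation_apply]
    ext1 i
    simp [← smul_mul_assoc]

lemma row_hom_apply {n : ℕ} {A : Rep.{v} k G} (f : rowRep k G n ⟶ A)
    (v : Fin n → MonoidAlgebra k G) :
    f.hom v = ∑ i, A.ρ.asAlgebraHom (v i) (f.hom (Pi.single i 1 : Fin n → MonoidAlgebra k G)) := by
  have hv : v = ∑ i, (rowRepresentation k G n).asAlgebraHom (v i) (Pi.single i 1) := by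
    simp_rw [asAlgebraHom_rowRepresentation]
    ext1 j
    simp [Pi.single_apply]
  conv_lhs => rw [hv]
  rw [map_sum]
  exact Finset.sum_congr rfl fun i _ => asAlgebraHom_hom f _ _

lemma rowLift_single {n : ℕ} (A : Rep.{v} k G) (x : Fin n → A) (i : Fin n) :
    (rowLift A x).hom (Pi.single i 1 : Fin n → MonoidAlgebra k G) = x i := by
  rw [rowLift_apply, Finset.sum_eq_single i]
  · simp
  · intro j _ hj
    simp [hj]
  · simp

lemma row_hom_ext {n : ℕ} {A : Rep.{v} k G} {f g : rowRep k G n ⟶ A}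
    (h : ∀ i, f.hom (Pi.single i 1 : Fin n → MonoidAlgebra k G) =
      g.hom (Pi.single i 1 : Fin n → MonoidAlgebra k G)) : f = g := by
  ext1
  refine DFunLike.ext _ _ fun v => ?_
  exact (row_hom_apply f v).trans (by simp only [h]; exact (row_hom_apply g v).symm)

instance rowRep_projective (n : ℕ) : Projective (rowRep k G n) where
  factors {E X} f e he := by
    rw [Rep.epi_iff_surjective] at he
    choose x hx using fun i => he (f.hom (Pi.single i 1 : Fin n → MonoidAlgebra k G))
    refine ⟨rowLift E x, row_hom_ext fun i => ?_⟩
    rw [← hx i]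
    exact congrArg e.hom (rowLift_single E x i)

/-- Right multiplication of row vectors by a matrix over `k[G]`. -/
noncomputable def vecMulHom {m n : ℕ} (M : Matrix (Fin m) (Fin n) (MonoidAlgebra k G)) :
    rowRep k G m ⟶ rowRep k G n :=
  Rep.ofHom
    { toLinearMap := (Matrix.vecMulLinear M).restrictScalars k
      isIntertwining' := fun g => by
        refine LinearMap.ext fun v => ?_
        exact (Matrix.vecMulLinear M).map_smul (MonoidAlgebra.of k G g) v }

/-- Data for a resolution of the trivial representation by based free modules of finite rank:
`rank n` is the rank in degree `n`, and row vectors are multiplied on the right by `bd n` to go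
from degree `n + 1` to degree `n`. Degree `0` has rank one and is mapped to `k` by the
augmentation. -/
structure MatrixResolution (k G : Type*) [CommRing k] [Group G] where
  /-- The rank of the free module in degree `n`. -/
  rank : ℕ → ℕ
  /-- The matrix of the differential from degree `n + 1` to degree `n`. -/
  bd (n : ℕ) : Matrix (Fin (rank (n + 1))) (Fin (rank n)) (MonoidAlgebra k G)
  rank_zero : rank 0 = 1
  bd_mul_bd (n : ℕ) : bd (n + 1) * bd n = 0
  augmentation_bd (i : Fin (rank 1)) (j : Fin (rank 0)) : augmentation k G (bd 0 i j) = 0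
  exact_zero (v : Fin (rank 0) → MonoidAlgebra k G) :
    (∀ i, augmentation k G (v i) = 0) → ∃ w, Matrix.vecMul w (bd 0) = v
  exact_succ (n : ℕ) (v : Fin (rank (n + 1)) → MonoidAlgebra k G) :
    Matrix.vecMul v (bd n) = 0 → ∃ w, Matrix.vecMul w (bd (n + 1)) = v

namespace MatrixResolution

variable (D : MatrixResolution k G)

/-- The chain complex of free representations given by the matrices. -/
noncomputable def complex : ChainComplex (Rep.{v} k G) ℕ :=
  ChainComplex.of (fun n => rowRep k G (D.rank n)) (fun n => vecMulHom (D.bd n)) fun n => by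
    ext1
    refine DFunLike.ext _ _ fun v => ?_
    change Matrix.vecMul (Matrix.vecMul v (D.bd (n + 1))) (D.bd n) = 0
    rw [Matrix.vecMul_vecMul, D.bd_mul_bd, Matrix.vecMul_zero]

lemma complex_d (n : ℕ) : D.complex.d (n + 1) n = vecMulHom (D.bd n) :=
  ChainComplex.of_d (fun n => rowRep k G (D.rank n)) (fun n => vecMulHom (D.bd n)) n

/-- The augmentation from degree zero of the complex. -/
noncomputable def aug : rowRep k G (D.rank 0) ⟶ Rep.trivial k G k :=
  rowLift _ fun _ => (1 : k)

lemma asAlgebraHom_trivial (x : MonoidAlgebra k G) (y : k) :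
    (Representation.trivial k G k).asAlgebraHom x y = augmentation k G x * y := by
  induction x using MonoidAlgebra.induction_linear with
  | zero => simp
  | add x z hx hz => simp [hx, hz, add_mul]
  | single g r => simp

lemma aug_apply (v : Fin (D.rank 0) → MonoidAlgebra k G) :
    D.aug.hom v = ∑ i, augmentation k G (v i) := by
  refine (rowLift_apply _ _ v).trans (Finset.sum_congr rfl fun i _ => ?_)
  exact (asAlgebraHom_trivial _ _).trans (mul_one _)

lemma d_comp_aug : D.complex.d 1 0 ≫ D.aug = 0 := by
  rw [D.complex_d 0]
  refine row_hom_ext fun i => ?_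
  refine (D.aug_apply (Matrix.vecMul (Pi.single i 1) (D.bd 0))).trans ?_
  exact Finset.sum_eq_zero fun j _ => by simp [D.augmentation_bd]

/-- The augmentation as a map to the complex concentrated in degree zero. -/
noncomputable def π : D.complex ⟶ (ChainComplex.single₀ (Rep.{v} k G)).obj (Rep.trivial k G k) :=
  (D.complex.toSingle₀Equiv _).symm ⟨D.aug, D.d_comp_aug⟩

lemma quasiIso_π : QuasiIso D.π where
  quasiIsoAt m := by
    induction m with
    | zero =>
      simp only [π]
      rw [ChainComplex.quasiIsoAt₀_iff, ShortComplex.quasiIso_iff_of_zeros' _ rfl rfl rfl]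
      constructor
      · apply (forget₂ _ (ModuleCat k)).reflects_exact_of_faithful
        rw [ShortComplex.moduleCat_exact_iff]
        intro x hx
        have hx' : (∑ i, augmentation k G ((x : Fin (D.rank 0) → MonoidAlgebra k G) i)) = 0 :=
          (D.aug_apply x).symm.trans hx
        obtain ⟨w, hw⟩ := D.exact_zero x fun i => by
          have : Subsingleton (Fin (D.rank 0)) := by rw [D.rank_zero]; infer_instance
          rwa [Fintype.sum_subsingleton _ i] at hx'
        refine ⟨w, ?_⟩
        change (D.complex.d 1 0).hom w = x
        rw [D.complex_d 0]
        exact hw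
      · rw [Rep.epi_iff_surjective]
        intro x
        refine ⟨fun _ => MonoidAlgebra.single 1 x, ?_⟩
        refine (D.aug_apply _).trans ?_
        simp only [Finset.sum_const, Finset.card_univ, Fintype.card_fin, D.rank_zero, one_smul]
        exact augmentation_single (k := k) (1 : G) x
    | succ m _ =>
      rw [quasiIsoAt_iff_exactAt' (hL := ChainComplex.exactAt_succ_single_obj ..),
          HomologicalComplex.exactAt_iff' _ (m + 2) (m + 1) m (by simp) (by simp)]
      apply (forget₂ _ (ModuleCat k)).reflects_exact_of_faithful
      rw [ShortComplex.moduleCat_exact_iff]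
      intro x hx
      have hx' : (D.complex.d (m + 1) m).hom x = 0 := hx
      rw [D.complex_d m] at hx'
      obtain ⟨w, hw⟩ := D.exact_succ m x hx'
      refine ⟨w, ?_⟩
      change (D.complex.d (m + 2) (m + 1)).hom w = x
      rw [D.complex_d (m + 1)]
      exact hw

/-- The projective resolution of the trivial representation given by the matrices. -/
noncomputable def toProjectiveResolution : ProjectiveResolution (Rep.trivial k G k) where
  complex := D.complex
  projective n := inferInstanceAs <| Projective (rowRep k G (D.rank n))
  π := D.π
  quasiIso := D.quasiIso_π

/-- The matrix over `k` of the coboundary from degree `n` to degree `n + 1`, for trivial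
coefficients. -/
noncomputable def coboundary (n : ℕ) : Matrix (Fin (D.rank (n + 1))) (Fin (D.rank n)) k :=
  (D.bd n).map (augmentation k G)

/-- The cochain complex of `k`-modules given by the augmented matrices. -/
noncomputable def cochains : CochainComplex (ModuleCat.{v} k) ℕ :=
  CochainComplex.of (fun n => ModuleCat.of k (Fin (D.rank n) → k))
    (fun n => ModuleCat.ofHom (D.coboundary n).mulVecLin) fun n => by
      ext1
      refine LinearMap.ext fun v => ?_
      change (D.coboundary (n + 1)).mulVec ((D.coboundary n).mulVec v) = 0
      rw [Matrix.mulVec_mulVec, coboundary, coboundary, ← Matrix.map_mul, D.bd_mul_bd]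
      simp

lemma cochains_d (n : ℕ) :
    D.cochains.d n (n + 1) = ModuleCat.ofHom (D.coboundary n).mulVecLin :=
  CochainComplex.of_d (fun n => ModuleCat.of k (Fin (D.rank n) → k))
    (fun n => ModuleCat.ofHom (D.coboundary n).mulVecLin) n

/-- A morphism from `k[G]ⁿ` to the trivial representation is determined by its values on the
standard basis, which are arbitrary. -/
noncomputable def homTrivialEquiv (k G : Type v) [CommRing k] [Group G] (n : ℕ) :
    (rowRep k G n ⟶ Rep.trivial k G k) ≃ₗ[k] (Fin n → k) where
  toFun f i := f.hom (Pi.single i 1 : Fin n → MonoidAlgebra k G)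
  map_add' _ _ := rfl
  map_smul' _ _ := rfl
  invFun x := rowLift _ x
  left_inv _ := row_hom_ext fun i => rowLift_single _ _ i
  right_inv _ := funext fun i => rowLift_single _ _ i

/-- Morphisms from the resolution to the trivial representation form the complex of augmented
matrices. -/
noncomputable def linearYonedaObjIso :
    D.complex.linearYonedaObj k (Rep.trivial k G k) ≅ D.cochains :=
  HomologicalComplex.Hom.isoOfComponents
    (fun n => (homTrivialEquiv k G (D.rank n)).toModuleIso) <| by
    rintro n _ ⟨rfl⟩
    ext1
    refine LinearMap.ext fun f => ?_
    rw [D.cochains_d]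
    change (D.coboundary n).mulVec (homTrivialEquiv k G (D.rank n) f) =
      homTrivialEquiv k G (D.rank (n + 1)) (D.complex.d (n + 1) n ≫ f)
    rw [D.complex_d]
    ext1 i
    refine Eq.trans ?_ (row_hom_apply (A := Rep.trivial k G k) f
      (Matrix.vecMul (Pi.single i 1) (D.bd n))).symm
    change ∑ j, D.coboundary n i j * homTrivialEquiv k G (D.rank n) f j = _
    refine Finset.sum_congr rfl fun j _ => ?_
    refine Eq.trans ?_ (asAlgebraHom_trivial _ _).symm
    simp [coboundary, homTrivialEquiv]

/-- Recognition principle for cohomology in positive degree: if `φ` is surjective on cocycles and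
its kernel there consists of the coboundaries, then its target is the cohomology group. -/
theorem nonempty_groupCohomology_equiv (n : ℕ) {Q : Type*} [AddCommGroup Q] [Module k Q]
    (φ : (Fin (D.rank (n + 1)) → k) →ₗ[k] Q)
    (hsurj : ∀ q, ∃ v, (D.coboundary (n + 1)).mulVec v = 0 ∧ φ v = q)
    (hker : ∀ v, (D.coboundary (n + 1)).mulVec v = 0 →
      (φ v = 0 ↔ ∃ w, (D.coboundary n).mulVec w = v)) :
    Nonempty (groupCohomology (Rep.trivial k G k) (n + 1) ≃ₗ[k] Q) := by
  let S := D.cochains.sc' n (n + 1) (n + 2)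
  have hf (w : Fin (D.rank n) → k) : S.f.hom w = (D.coboundary n).mulVec w :=
    congrArg (fun f => f.hom w) (D.cochains_d n)
  have hg (v : Fin (D.rank (n + 1)) → k) : S.g.hom v = (D.coboundary (n + 1)).mulVec v :=
    congrArg (fun f => f.hom v) (D.cochains_d (n + 1))
  let ψ : LinearMap.ker S.g.hom →ₗ[k] Q :=
    LinearMap.comp (M₂ := Fin (D.rank (n + 1)) → k) φ (LinearMap.ker S.g.hom).subtype
  have hψ : Function.Surjective ψ := fun q => by
    obtain ⟨v, hv, rfl⟩ := hsurj q
    exact ⟨⟨v, (hg v).trans hv⟩, rfl⟩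
  have hrange : LinearMap.range S.moduleCatToCycles = LinearMap.ker ψ := by
    ext ⟨v, hv⟩
    have hv' : (D.coboundary (n + 1)).mulVec v = 0 := (hg v).symm.trans hv
    refine Iff.trans ⟨?_, ?_⟩ (hker v hv').symm
    · rintro ⟨w, hw⟩
      exact ⟨w, (hf w).symm.trans (congrArg Subtype.val hw)⟩
    · rintro ⟨w, hw⟩
      exact ⟨w, Subtype.ext ((hf w).trans hw)⟩
  exact ⟨(groupCohomologyIso (Rep.trivial k G k) (n + 1) D.toProjectiveResolution ≪≫
    HomologicalComplex.homologyMapIso D.linearYonedaObjIso (n + 1) ≪≫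
    D.cochains.homologyIsoSc' n (n + 1) (n + 2) (by simp) (by simp) ≪≫
    S.moduleCatHomologyIso).toLinearEquiv ≪≫ₗ
    Submodule.quotEquivOfEq _ _ hrange ≪≫ₗ ψ.quotKerEquivOfSurjective hψ⟩

end MatrixResolution

end Resolution

/-! ### Zero divisors and left ideals in group rings -/

section GroupRing

variable {k G : Type*} [CommRing k] [Group G]

/-- A finitely supported function invariant under an injective map without periodic points
vanishes: its support would contain an infinite orbit. -/
lemma Finsupp.eq_zero_of_mapDomain_eq_self {X : Type*} {f : X →₀ k} {π : X → X}
    (hπ : Function.Injective π) (hfree : ∀ x n, π^[n] x = x → n = 0)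
    (hf : f.mapDomain π = f) : f = 0 := by
  ext x
  by_contra hx
  have hstep (y : X) : f (π y) = f y := by
    conv_lhs => rw [← hf]
    exact Finsupp.mapDomain_apply hπ f y
  have horbit (n : ℕ) : f (π^[n] x) = f x := by
    induction n with
    | zero => rfl
    | succ n ih => rw [Function.iterate_succ_apply', hstep, ih]
  have hinj : Function.Injective fun n : ℕ => π^[n] x := by
    intro m n hmn
    wlog hle : m ≤ n generalizing m n
    · exact (this hmn.symm (by lia)).symm
    obtain ⟨d, rfl⟩ := Nat.exists_eq_add_of_le hle
    have h : π^[m] (π^[d] x) = π^[m] x := by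
      rw [← Function.iterate_add_apply]
      exact hmn.symm
    rw [hfree x d (hπ.iterate m h), add_zero]
  refine not_injective_infinite_finite
    (fun n : ℕ => (⟨π^[n] x, ?_⟩ : f.support)) fun m n h => hinj (congrArg Subtype.val h)
  rw [Finsupp.mem_support_iff, horbit]
  exact hx

namespace MonoidAlgebra

/-- Over a group element `v` of infinite order, `v - 1` is not a right zero divisor. -/
lemma eq_zero_of_mul_of_sub_one_eq_zero {v : G} (hv : ∀ n : ℕ, v ^ n = 1 → n = 0)
    {x : MonoidAlgebra k G} (hx : x * (of k G v - 1) = 0) : x = 0 := by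
  have hiter (g : G) (n : ℕ) : (fun g => g * v)^[n] g = g * v ^ n := by
    induction n with
    | zero => simp
    | succ n ih => rw [Function.iterate_succ_apply', ih, pow_succ, mul_assoc]
  have hmul (y : MonoidAlgebra k G) : (y * of k G v).coeff = y.coeff.mapDomain (· * v) := by
    induction y using MonoidAlgebra.induction_linear with
    | zero => simp
    | add y z hy hz => rw [add_mul, coeff_add, hy, hz, coeff_add, Finsupp.mapDomain_add]
    | single g r => simp
  have : x.coeff = 0 := by
    refine Finsupp.eq_zero_of_mapDomain_eq_self (mul_left_injective v) (fun g n h => hv n ?_)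
      (f := x.coeff) (π := (· * v)) ?_
    · rw [hiter] at h
      simpa using h
    · rw [← hmul]
      rw [mul_sub, mul_one, sub_eq_zero] at hx
      rw [hx]
  exact MonoidAlgebra.ext this

lemma of_sub_one_mem_span {S : Set G} {g : G} (hg : g ∈ Subgroup.closure S) :
    of k G g - 1 ∈ Ideal.span ((fun s => of k G s - 1) '' S) := by
  induction hg using Subgroup.closure_induction with
  | mem s hs => exact Ideal.subset_span ⟨s, hs, rfl⟩
  | one => rw [map_one, sub_self]; exact zero_mem _
  | mul g h _ _ hg hh =>
    have : of k G (g * h) - 1 = of k G g * (of k G h - 1) + (of k G g - 1) := by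
      rw [map_mul]; noncomm_ring
    rw [this]
    exact add_mem (Ideal.mul_mem_left _ _ hh) hg
  | inv g _ hg =>
    have : of k G g⁻¹ - 1 = -of k G g⁻¹ * (of k G g - 1) := by
      rw [mul_sub, neg_mul, ← map_mul, inv_mul_cancel, map_one]; noncomm_ring
    rw [this]
    exact Ideal.mul_mem_left _ _ hg

/-- The kernel of `k[G] → k[G ⧸ H]` is generated as a left ideal by the elements `s - 1`, for `s`
in a generating set of `H`. -/
lemma mem_span_of_mapDomain_mk_eq_zero {S : Set G} {x : MonoidAlgebra k G}
    (hx : x.coeff.mapDomain (QuotientGroup.mk : G → G ⧸ Subgroup.closure S) = 0) :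
    x ∈ Ideal.span ((fun s => of k G s - 1) '' S) := by
  have key (y : MonoidAlgebra k G) : y - ofCoeff ((y.coeff.mapDomain
      (QuotientGroup.mk : G → G ⧸ Subgroup.closure S)).mapDomain Quotient.out) ∈
      Ideal.span ((fun s => of k G s - 1) '' S) := by
    induction y using MonoidAlgebra.induction_linear with
    | zero => simp
    | add y z hy hz =>
      rw [coeff_add, Finsupp.mapDomain_add, Finsupp.mapDomain_add, ofCoeff_add, add_sub_add_comm]
      exact add_mem hy hz
    | single g r =>
      obtain ⟨h, hh⟩ := QuotientGroup.mk_out_eq_mul (Subgroup.closure S) g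
      have : (single g r : MonoidAlgebra k G) - single (g * h) r =
          -(single g r * (of k G (h : G) - 1)) := by
        simp [mul_sub]
      rw [coeff_single, Finsupp.mapDomain_single, Finsupp.mapDomain_single, hh]
      change (single g r : MonoidAlgebra k G) - single (g * h) r ∈ _
      rw [this]
      exact neg_mem (Ideal.mul_mem_left _ _ (of_sub_one_mem_span h.2))
  simpa [hx] using key x

/-- A left multiple of `v - 1` dies in `k[G ⧸ H]` when `v ∈ H`. -/
lemma mapDomain_mk_mul_of_sub_one {S : Set G} {v : G} (hv : v ∈ Subgroup.closure S)
    (y : MonoidAlgebra k G) :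
    (y * (of k G v - 1)).coeff.mapDomain
      (QuotientGroup.mk : G → G ⧸ Subgroup.closure S) = 0 := by
  induction y using MonoidAlgebra.induction_linear with
  | zero => simp
  | add y z hy hz => rw [add_mul, coeff_add, Finsupp.mapDomain_add, hy, hz, add_zero]
  | single g r =>
    have : (QuotientGroup.mk (g * v) : G ⧸ Subgroup.closure S) = QuotientGroup.mk g := by
      rw [QuotientGroup.mk_mul_of_mem _ hv]
    rw [mul_sub, of_apply, single_mul_single, mul_one, mul_one, sub_eq_add_neg, ← single_neg,
      coeff_add, Finsupp.mapDomain_add, coeff_single, coeff_single, Finsupp.mapDomain_single,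
      Finsupp.mapDomain_single, this, ← Finsupp.single_add, add_neg_cancel, Finsupp.single_zero]

/-- If `u` and `v` commute and no positive power of `u` lies in `⟨v⟩`, then `u - 1` is not a right
zero divisor modulo the left ideal generated by `v - 1`. -/
lemma exists_eq_mul_of_mul_of_sub_one_eq {u v : G} (huv : Commute u v)
    (hu : ∀ n : ℕ, u ^ n ∈ Subgroup.zpowers v → n = 0) {x y : MonoidAlgebra k G}
    (hxy : x * (of k G u - 1) = y * (of k G v - 1)) : ∃ w, x = w * (of k G v - 1) := by
  have hcl : Subgroup.closure {v} = Subgroup.zpowers v := (Subgroup.zpowers_eq_closure v).symm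
  let H := Subgroup.closure {v}
  have hcomm {h : G} (hh : h ∈ H) : u * h = h * u := by
    rw [show H = _ from hcl] at hh
    obtain ⟨n, rfl⟩ := hh
    exact (huv.zpow_right n).eq
  -- Right multiplication by `u` on `G ⧸ ⟨v⟩`.
  let π : G ⧸ H → G ⧸ H := Quotient.map' (· * u) fun g h hgh => by
    rw [QuotientGroup.leftRel_apply] at hgh ⊢
    rwa [show (g * u)⁻¹ * (h * u) = u⁻¹ * (g⁻¹ * h * u) by group, ← hcomm hgh,
      inv_mul_cancel_left]
  have hπ (g : G) : π (QuotientGroup.mk g) = QuotientGroup.mk (g * u) := rfl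
  have hiter (g : G) (n : ℕ) : π^[n] (QuotientGroup.mk g) = QuotientGroup.mk (g * u ^ n) := by
    induction n with
    | zero => simp
    | succ n ih => rw [Function.iterate_succ_apply', ih, hπ, pow_succ, mul_assoc]
  have hinj : Function.Injective π := by
    intro a b
    induction a using QuotientGroup.induction_on with | H g =>
    induction b using QuotientGroup.induction_on with | H h =>
    rw [hπ, hπ, QuotientGroup.eq, QuotientGroup.eq]
    intro hgh
    rwa [show g⁻¹ * h = u * ((g * u)⁻¹ * (h * u)) * u⁻¹ by group, hcomm hgh,
      mul_inv_cancel_right]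
  have hfree (a : G ⧸ H) (n : ℕ) (h : π^[n] a = a) : n = 0 := by
    induction a using QuotientGroup.induction_on with | H g =>
    rw [hiter, eq_comm, QuotientGroup.eq, inv_mul_cancel_left] at h
    exact hu n (hcl ▸ h)
  have hmul (y : MonoidAlgebra k G) : (y * of k G u).coeff.mapDomain
      (QuotientGroup.mk : G → G ⧸ H) = (y.coeff.mapDomain QuotientGroup.mk).mapDomain π := by
    induction y using MonoidAlgebra.induction_linear with
    | zero => simp
    | add y z hy hz =>
      rw [add_mul, coeff_add, Finsupp.mapDomain_add, hy, hz, coeff_add, Finsupp.mapDomain_add,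
        Finsupp.mapDomain_add]
    | single g r => simp [hπ]
  have hx : x.coeff.mapDomain (QuotientGroup.mk : G → G ⧸ H) = 0 := by
    refine Finsupp.eq_zero_of_mapDomain_eq_self hinj hfree ?_
    rw [← hmul, show x * of k G u = y * (of k G v - 1) + x by rw [← hxy]; noncomm_ring,
      coeff_add, Finsupp.mapDomain_add,
      mapDomain_mk_mul_of_sub_one (Subgroup.mem_closure_singleton_self v), zero_add]
  have := mem_span_of_mapDomain_mk_eq_zero hx
  rw [Set.image_singleton, Ideal.mem_span_singleton'] at this
  obtain ⟨w, hw⟩ := this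
  exact ⟨w, hw.symm⟩

/-- An element of `k[G]` fixed under right multiplication by an involution `c` is a left multiple
of `c + 1`, provided `c` is detected by a sign character. -/
lemma exists_eq_mul_of_add_one {c : G} (hc : c * c = 1) (θ : G →* ℤˣ) (hθ : θ c = -1)
    {x : MonoidAlgebra k G} (hx : x * of k G c = x) : ∃ y, x = y * (of k G c + 1) := by
  classical
  refine ⟨ofCoeff (x.coeff.filter fun g => θ g = 1), ?_⟩
  have hc' : c⁻¹ = c := inv_eq_of_mul_eq_one_right hc
  have hxc (g : G) : x.coeff (g * c) = x.coeff g := by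
    conv_rhs => rw [← hx]
    rw [of_apply, coeff_mul_single_apply, hc', mul_one]
  ext g
  rw [mul_add, mul_one, coeff_add, Finsupp.add_apply, of_apply, coeff_mul_single_apply, hc',
    mul_one, coeff_ofCoeff, Finsupp.filter_apply, Finsupp.filter_apply, map_mul, hθ, hxc]
  rcases Int.units_eq_one_or (θ g) with h | h <;> simp [h]

/-- The quotient `(g ^ n - 1) / (g - 1)` exists for every integer `n`, with augmentation `n`. -/
lemma exists_mul_of_sub_one_eq_zpow (g : G) (n : ℤ) :
    ∃ N : MonoidAlgebra k G, N * (of k G g - 1) = of k G (g ^ n) - 1 ∧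
      augmentation k G N = n := by
  induction n using Int.induction_on with
  | zero => exact ⟨0, by simp [one_def]⟩
  | succ n ih =>
    obtain ⟨N, hN, hN'⟩ := ih
    refine ⟨N + of k G (g ^ (n : ℤ)), ?_, by simp [hN']⟩
    rw [add_mul, hN, zpow_add_one, map_mul]
    noncomm_ring
  | pred n ih =>
    obtain ⟨N, hN, hN'⟩ := ih
    refine ⟨N - of k G (g ^ (-(n : ℤ) - 1)), ?_, by simp [hN']⟩
    rw [sub_mul, hN, mul_sub, ← map_mul, ← zpow_add_one, sub_add_cancel]
    noncomm_ring

/-- An element of the group ring with augmentation zero is a combination of the elements `s - 1`,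
for `s` in a generating set of the group. -/
lemma mem_span_of_augmentation_eq_zero {S : Set G} (hS : Subgroup.closure S = ⊤)
    {x : MonoidAlgebra k G} (hx : augmentation k G x = 0) :
    x ∈ Ideal.span ((fun s => of k G s - 1) '' S) := by
  refine mem_span_of_mapDomain_mk_eq_zero ?_
  have hsub : Subsingleton (G ⧸ Subgroup.closure S) := by
    rw [hS]; exact QuotientGroup.subsingleton_quotient_top
  have key (y : MonoidAlgebra k G) (q : G ⧸ Subgroup.closure S) :
      y.coeff.mapDomain (QuotientGroup.mk : G → G ⧸ Subgroup.closure S) q =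
        augmentation k G y := by
    induction y using MonoidAlgebra.induction_linear with
    | zero => simp
    | add y z hy hz => rw [coeff_add, Finsupp.mapDomain_add, Finsupp.add_apply, hy, hz, map_add]
    | single g r =>
      rw [coeff_single, Finsupp.mapDomain_single, Subsingleton.elim q (QuotientGroup.mk g)]
      simp
  ext q
  rw [key, hx, Finsupp.zero_apply]

end MonoidAlgebra

end GroupRing

/-! ### The sapphire group and its torus subgroup -/

namespace SapphireGroup

variable {r s t u : ℤ}

/-- The generator `a₁` of the sapphire group. -/
def a (r s t u : ℤ) : SapphireGroup r s t u := PresentedGroup.of SapphireGen.a₁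

/-- The generator `b₁` of the sapphire group. -/
def b (r s t u : ℤ) : SapphireGroup r s t u := PresentedGroup.of SapphireGen.b₁

/-- The generator `a₂` of the sapphire group. -/
def c (r s t u : ℤ) : SapphireGroup r s t u := PresentedGroup.of SapphireGen.a₂

/-- The element `a₁ ^ (2 * t) * b₁ ^ u`, which together with `a₂` generates the second Klein bottle
group. -/
def z (r s t u : ℤ) : SapphireGroup r s t u := a r s t u ^ (2 * t) * b r s t u ^ u

lemma closure_generators :
    Subgroup.closure {a r s t u, b r s t u, c r s t u} = ⊤ := by
  rw [← PresentedGroup.closure_range_of (Sapphire.relators r s t u)]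
  congr 1
  ext g
  constructor
  · rintro (rfl | rfl | rfl)
    exacts [⟨_, rfl⟩, ⟨_, rfl⟩, ⟨_, rfl⟩]
  · rintro ⟨x, rfl⟩
    rcases x with _ | _ | _
    exacts [.inl rfl, .inr (.inl rfl), .inr (.inr rfl)]

lemma a_mul_b : a r s t u * b r s t u * (a r s t u)⁻¹ = (b r s t u)⁻¹ :=
  eq_of_mul_inv_eq_one <| PresentedGroup.one_of_mem (rels := Sapphire.relators r s t u)
    (x := Sapphire.a₁ * Sapphire.b₁ * Sapphire.a₁⁻¹ * (Sapphire.b₁⁻¹)⁻¹) (.inl rfl)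

lemma c_sq : c r s t u ^ 2 = a r s t u ^ (2 * r) * b r s t u ^ s :=
  eq_of_mul_inv_eq_one <| PresentedGroup.one_of_mem (rels := Sapphire.relators r s t u)
    (x := Sapphire.a₂ ^ 2 * (Sapphire.a₁ ^ (2 * r) * Sapphire.b₁ ^ s)⁻¹) (.inr (.inl rfl))

lemma c_mul_z : c r s t u * z r s t u * (c r s t u)⁻¹ = (z r s t u)⁻¹ := by
  have : c r s t u * a r s t u ^ (2 * t) * b r s t u ^ u * (c r s t u)⁻¹ =
      b r s t u ^ (-u) * a r s t u ^ (-(2 * t)) :=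
    eq_of_mul_inv_eq_one <| PresentedGroup.one_of_mem (rels := Sapphire.relators r s t u)
      (x := Sapphire.a₂ * Sapphire.a₁ ^ (2 * t) * Sapphire.b₁ ^ u * Sapphire.a₂⁻¹ *
        (Sapphire.b₁ ^ (-u) * Sapphire.a₁ ^ (-(2 * t)))⁻¹) (.inr (.inr rfl))
  rw [z, ← mul_assoc, this, mul_inv_rev, zpow_neg, zpow_neg]

/-- The Klein bottle relation in a form without inverses. -/
lemma b_a_b : b r s t u * a r s t u * b r s t u = a r s t u := by
  rw [mul_assoc, ← eq_inv_mul_iff_mul_eq, ← a_mul_b]; group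

/-- The second Klein bottle relation in a form without inverses. -/
lemma z_c_z : z r s t u * c r s t u * z r s t u = c r s t u := by
  rw [mul_assoc, ← eq_inv_mul_iff_mul_eq, ← c_mul_z]; group

lemma commute_a_sq_b : Commute (a r s t u ^ 2) (b r s t u) := by
  have h : SemiconjBy (a r s t u) (b r s t u) (b r s t u)⁻¹ := by
    rw [SemiconjBy, ← a_mul_b, inv_mul_cancel_right]
  have := h.inv_right.mul_left h
  rwa [inv_inv, ← sq] at this

lemma commute_c_sq_z : Commute (c r s t u ^ 2) (z r s t u) := by
  have h : SemiconjBy (c r s t u) (z r s t u) (z r s t u)⁻¹ := by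
    rw [SemiconjBy, ← c_mul_z, inv_mul_cancel_right]
  have := h.inv_right.mul_left h
  rwa [inv_inv, ← sq] at this

lemma c_sq_zpow_mul_z_zpow (m n : ℤ) : (c r s t u ^ 2) ^ m * z r s t u ^ n =
    (a r s t u ^ 2) ^ (r * m + t * n) * b r s t u ^ (s * m + u * n) := by
  have key (i j i' j' : ℤ) : (a r s t u ^ 2) ^ i * b r s t u ^ j *
      ((a r s t u ^ 2) ^ i' * b r s t u ^ j') =
      (a r s t u ^ 2) ^ (i + i') * b r s t u ^ (j + j') := by
    rw [mul_assoc, ← mul_assoc (b r s t u ^ j), ← (commute_a_sq_b.zpow_zpow i' j).eq, zpow_add,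
      zpow_add]
    simp only [mul_assoc]
  rw [c_sq, z, zpow_mul, zpow_mul, zpow_two, ← sq, (commute_a_sq_b.zpow_zpow r s).mul_zpow,
    (commute_a_sq_b.zpow_zpow t u).mul_zpow, ← zpow_mul, ← zpow_mul, ← zpow_mul, ← zpow_mul, key]

/-- Homomorphisms out of the sapphire group. -/
def lift {H : Type*} [Group H] (x y w : H) (h₁ : x * y * x⁻¹ = y⁻¹)
    (h₂ : w ^ 2 = x ^ (2 * r) * y ^ s)
    (h₃ : w * (x ^ (2 * t) * y ^ u) * w⁻¹ = (x ^ (2 * t) * y ^ u)⁻¹) : SapphireGroup r s t u →* H :=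
  PresentedGroup.toGroup (f := fun | .a₁ => x | .b₁ => y | .a₂ => w) <| by
    rintro _ (rfl | rfl | rfl)
    · simp [Sapphire.a₁, Sapphire.b₁, h₁]
    · simp [Sapphire.a₁, Sapphire.b₁, Sapphire.a₂, h₂]
    · rw [mul_inv_rev, ← zpow_neg, ← zpow_neg] at h₃
      simp only [Sapphire.a₁, Sapphire.b₁, Sapphire.a₂, map_mul, map_inv, map_zpow,
        FreeGroup.lift_apply_of]
      rw [mul_inv_eq_one, ← h₃, mul_assoc w]

section lift

variable {H : Type*} [Group H] (x y w : H) (h₁ : x * y * x⁻¹ = y⁻¹)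
    (h₂ : w ^ 2 = x ^ (2 * r) * y ^ s)
    (h₃ : w * (x ^ (2 * t) * y ^ u) * w⁻¹ = (x ^ (2 * t) * y ^ u)⁻¹)

@[simp]
lemma lift_a : lift x y w h₁ h₂ h₃ (a r s t u) = x := PresentedGroup.toGroup.of _

@[simp]
lemma lift_b : lift x y w h₁ h₂ h₃ (b r s t u) = y := PresentedGroup.toGroup.of _

@[simp]
lemma lift_c : lift x y w h₁ h₂ h₃ (c r s t u) = w := PresentedGroup.toGroup.of _

end lift

/-- The sign character that is nontrivial exactly on the generator `a₂`. -/
def sign (r s t u : ℤ) : SapphireGroup r s t u →* ℤˣ :=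
  lift 1 1 (-1) (by simp) (by simp) (by simp)

/-- The action on the Bass–Serre tree of the decomposition into two Klein bottle groups. The tree is
a line: `a₁` and `a₂` reflect it in adjacent vertices, and the torus subgroup acts trivially. -/
def toDihedral (r s t u : ℤ) : SapphireGroup r s t u →* DihedralGroup 0 :=
  lift (.sr 0) 1 (.sr 1) (by simp)
    (by rw [zpow_mul, zpow_two]; simp [sq])
    (by rw [zpow_mul, zpow_two]; simp)

/-- The glide reflection of the lattice `ℤ × ℤ` by which the generator `a₁` acts. -/
def glide : Equiv.Perm (ℤ × ℤ) where
  toFun p := (p.1 + 1, -p.2)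
  invFun p := (p.1 - 1, -p.2)
  left_inv p := by simp
  right_inv p := by simp

lemma glide_zpow (n : ℤ) : glide ^ (2 * n) = Equiv.addRight ((2 * n, 0) : ℤ × ℤ) := by
  have : glide ^ (2 : ℤ) = Equiv.addRight ((2, 0) : ℤ × ℤ) := by
    refine Equiv.ext fun p => Prod.ext ?_ ?_
    · change p.1 + 1 + 1 = p.1 + 2
      ring
    · change - -p.2 = p.2 + 0
      ring
  rw [zpow_mul, this, Equiv.zsmul_addRight]
  simp [mul_comm]

lemma addRight_zpow_snd (n : ℤ) :
    Equiv.addRight ((0, 2) : ℤ × ℤ) ^ n = Equiv.addRight ((0, 2 * n) : ℤ × ℤ) := by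
  rw [Equiv.zsmul_addRight]
  simp [mul_comm]

/-- The reflection of `ℤ × ℤ` fixing `(r, s)` and negating `(t, u)`. -/
def reflection (r s t u : ℤ) (hdet : (r * u - s * t) * (r * u - s * t) = 1) :
    Equiv.Perm (ℤ × ℤ) :=
  Function.Involutive.toPerm
    (fun p => (p.1 - 2 * (r * u - s * t) * (r * p.2 - s * p.1) * t,
      p.2 - 2 * (r * u - s * t) * (r * p.2 - s * p.1) * u)) fun p => by
    ext
    · linear_combination 4 * (r * p.2 - s * p.1) * (r * u - s * t) * t * hdet
    · linear_combination 4 * (r * p.2 - s * p.1) * (r * u - s * t) * u * hdet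

/-- The affine action of the sapphire group on the lattice `ℤ × ℤ`, in which the torus subgroup
`⟨a₁², b₁⟩` acts by translations by `2ℤ × 2ℤ`. -/
def affineAction (r s t u : ℤ) (hdet : (r * u - s * t) * (r * u - s * t) = 1) :
    SapphireGroup r s t u →* Equiv.Perm (ℤ × ℤ) :=
  lift glide (Equiv.addRight (0, 2)) (Equiv.addRight (r, s) * reflection r s t u hdet)
    (by
      rw [mul_inv_eq_iff_eq_mul, eq_inv_mul_iff_mul_eq]
      refine Equiv.ext fun p => Prod.ext ?_ ?_
      · change p.1 + 0 + 1 + 0 = p.1 + 1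
        ring
      · change -(p.2 + 2) + 2 = -p.2
        ring)
    (by
      rw [glide_zpow, addRight_zpow_snd, sq]
      refine Equiv.ext fun p => Prod.ext ?_ ?_
      · change (p.1 - 2 * (r * u - s * t) * (r * p.2 - s * p.1) * t + r) -
          2 * (r * u - s * t) * (r * (p.2 - 2 * (r * u - s * t) * (r * p.2 - s * p.1) * u + s) -
          s * (p.1 - 2 * (r * u - s * t) * (r * p.2 - s * p.1) * t + r)) * t + r =
          p.1 + 0 + 2 * r
        linear_combination 4 * (r * p.2 - s * p.1) * (r * u - s * t) * t * hdet
      · change (p.2 - 2 * (r * u - s * t) * (r * p.2 - s * p.1) * u + s) -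
          2 * (r * u - s * t) * (r * (p.2 - 2 * (r * u - s * t) * (r * p.2 - s * p.1) * u + s) -
          s * (p.1 - 2 * (r * u - s * t) * (r * p.2 - s * p.1) * t + r)) * u + s =
          p.2 + 2 * s + 0
        linear_combination 4 * (r * p.2 - s * p.1) * (r * u - s * t) * u * hdet)
    (by
      rw [glide_zpow, addRight_zpow_snd, mul_inv_eq_iff_eq_mul, eq_inv_mul_iff_mul_eq]
      refine Equiv.ext fun p => Prod.ext ?_ ?_
      · change (p.1 + 0 + 2 * t) - 2 * (r * u - s * t) *
          (r * (p.2 + 2 * u + 0) - s * (p.1 + 0 + 2 * t)) * t + r + 0 + 2 * t =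
          p.1 - 2 * (r * u - s * t) * (r * p.2 - s * p.1) * t + r
        linear_combination -4 * t * hdet
      · change (p.2 + 2 * u + 0) - 2 * (r * u - s * t) *
          (r * (p.2 + 2 * u + 0) - s * (p.1 + 0 + 2 * t)) * u + s + 2 * u + 0 =
          p.2 - 2 * (r * u - s * t) * (r * p.2 - s * p.1) * u + s
        linear_combination -4 * u * hdet)

/-- The elements `a₁²` and `b₁` generate a free abelian group of rank two. -/
lemma eq_zero_of_a_sq_zpow_mul_b_zpow_eq_one
    (hdet : (r * u - s * t) * (r * u - s * t) = 1) {i j : ℤ}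
    (h : (a r s t u ^ 2) ^ i * b r s t u ^ j = 1) : i = 0 ∧ j = 0 := by
  have h' := congrArg (fun g => affineAction r s t u hdet g (0, 0)) h
  rw [← zpow_natCast, ← zpow_mul] at h'
  simp only [map_mul, map_zpow, affineAction, lift_a, lift_b, Nat.cast_ofNat, glide_zpow,
    addRight_zpow_snd, map_one] at h'
  obtain ⟨h₁, h₂⟩ := Prod.ext_iff.1 h'
  change 0 + 0 + 2 * i = 0 at h₁
  change 0 + 2 * j + 0 = 0 at h₂
  lia

/-- The elements `a₂²` and `z` generate a free abelian group of rank two. -/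
lemma eq_zero_of_c_sq_zpow_mul_z_zpow_eq_one
    (hdet : (r * u - s * t) * (r * u - s * t) = 1) {i j : ℤ}
    (h : (c r s t u ^ 2) ^ i * z r s t u ^ j = 1) : i = 0 ∧ j = 0 := by
  rw [c_sq_zpow_mul_z_zpow] at h
  obtain ⟨h₁, h₂⟩ := eq_zero_of_a_sq_zpow_mul_b_zpow_eq_one hdet h
  constructor
  · linear_combination (r * u - s * t) * (u * h₁ - t * h₂) - i * hdet
  · linear_combination (r * u - s * t) * (r * h₂ - s * h₁) - j * hdet

/-- The torus subgroup, common to the two Klein bottle groups. -/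
def torus (r s t u : ℤ) : Subgroup (SapphireGroup r s t u) :=
  Subgroup.closure {c r s t u ^ 2, z r s t u}

lemma a_sq_zpow_mul_b_zpow_mem_torus (hdet : (r * u - s * t) * (r * u - s * t) = 1) (i j : ℤ) :
    (a r s t u ^ 2) ^ i * b r s t u ^ j ∈ torus r s t u := by
  have h : (c r s t u ^ 2) ^ ((r * u - s * t) * (u * i - t * j)) *
      z r s t u ^ ((r * u - s * t) * (r * j - s * i)) =
      (a r s t u ^ 2) ^ i * b r s t u ^ j := by
    rw [c_sq_zpow_mul_z_zpow]
    congr 2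
    · linear_combination i * hdet
    · linear_combination j * hdet
  rw [← h]
  exact mul_mem (zpow_mem (Subgroup.subset_closure (.inl rfl)) _)
    (zpow_mem (Subgroup.subset_closure (.inr rfl)) _)

lemma torus_eq_closure (hdet : (r * u - s * t) * (r * u - s * t) = 1) :
    torus r s t u = Subgroup.closure {a r s t u ^ 2, b r s t u} := by
  refine le_antisymm ((Subgroup.closure_le _).2 ?_) ((Subgroup.closure_le _).2 ?_)
  · have key (m n : ℤ) : (c r s t u ^ 2) ^ m * z r s t u ^ n ∈
        Subgroup.closure {a r s t u ^ 2, b r s t u} := by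
      rw [c_sq_zpow_mul_z_zpow]
      exact mul_mem (zpow_mem (Subgroup.subset_closure (.inl rfl)) _)
        (zpow_mem (Subgroup.subset_closure (.inr rfl)) _)
    rintro _ (rfl | rfl)
    · simpa using key 1 0
    · simpa using key 0 1
  · rintro _ (rfl | rfl)
    · simpa using a_sq_zpow_mul_b_zpow_mem_torus hdet 1 0
    · simpa using a_sq_zpow_mul_b_zpow_mem_torus hdet 0 1

/-- In a Klein bottle group `⟨x, y ∣ y x y = x⟩`, the generator `x` normalizes `⟨x², y⟩`. -/
lemma mem_normalizer_of_klein {G : Type*} [Group G] {x y : G} (h : y * x * y = x) :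
    x ∈ Subgroup.normalizer (Subgroup.closure {x ^ 2, y} : Set G) := by
  have h₁ : x * y * x⁻¹ = y⁻¹ := by
    rw [mul_inv_eq_iff_eq_mul, eq_inv_mul_iff_mul_eq, ← mul_assoc, h]
  have h₂ : x⁻¹ * y * x = y⁻¹ := by
    rw [eq_inv_iff_mul_eq_one, mul_assoc, mul_assoc, ← mul_assoc y, h, inv_mul_cancel]
  have hx : x ^ 2 ∈ Subgroup.closure {x ^ 2, y} := Subgroup.subset_closure (.inl rfl)
  have hy : y ∈ Subgroup.closure {x ^ 2, y} := Subgroup.subset_closure (.inr rfl)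
  have hle (w : G) (hw : ∀ g ∈ ({x ^ 2, y} : Set G), w * g * w⁻¹ ∈ Subgroup.closure {x ^ 2, y})
      (g : G) (hg : g ∈ Subgroup.closure {x ^ 2, y}) :
      w * g * w⁻¹ ∈ Subgroup.closure {x ^ 2, y} :=
    (Subgroup.closure_le ((Subgroup.closure {x ^ 2, y}).comap (MulAut.conj w).toMonoidHom)).2 hw hg
  rw [Subgroup.mem_normalizer_iff]
  refine fun g => ⟨hle x ?_ g, fun hg => ?_⟩
  · rintro _ (rfl | rfl)
    · convert hx using 1
      group
    · rw [h₁]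
      exact inv_mem hy
  · have := hle x⁻¹ ?_ _ hg
    · convert this using 1
      group
    · rintro _ (rfl | rfl)
      · convert hx using 1
        group
      · rw [inv_inv, h₂]
        exact inv_mem hy

lemma torus_normal (hdet : (r * u - s * t) * (r * u - s * t) = 1) : (torus r s t u).Normal := by
  rw [← Subgroup.normalizer_eq_top_iff, eq_top_iff, ← closure_generators, Subgroup.closure_le]
  rintro _ (rfl | rfl | rfl)
  · rw [torus_eq_closure hdet]
    exact mem_normalizer_of_klein b_a_b
  · refine Subgroup.le_normalizer ?_
    simpa using a_sq_zpow_mul_b_zpow_mem_torus hdet 0 1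
  · exact mem_normalizer_of_klein z_c_z

lemma torus_le_ker_toDihedral : torus r s t u ≤ (toDihedral r s t u).ker := by
  refine (Subgroup.closure_le _).2 ?_
  rintro _ (rfl | rfl)
  · simp [MonoidHom.mem_ker, toDihedral, sq]
  · rw [SetLike.mem_coe, MonoidHom.mem_ker, z, zpow_mul, zpow_two]
    simp [toDihedral]

lemma torus_le_ker_sign : torus r s t u ≤ (sign r s t u).ker := by
  refine (Subgroup.closure_le _).2 ?_
  rintro _ (rfl | rfl)
  · simp [MonoidHom.mem_ker, sign]
  · simp [MonoidHom.mem_ker, sign, z]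

/-- The translation `a₁ a₂` of the Bass–Serre tree has infinite order modulo the torus. -/
lemma eq_zero_of_a_mul_c_pow_mem_torus {n : ℕ}
    (h : (a r s t u * c r s t u) ^ n ∈ torus r s t u) : n = 0 := by
  have := torus_le_ker_toDihedral h
  rw [MonoidHom.mem_ker, map_pow, map_mul, toDihedral, lift_a, lift_c, DihedralGroup.sr_mul_sr,
    sub_zero, DihedralGroup.r_one_pow] at this
  have h' : ((n : ZMod 0)) = 0 := DihedralGroup.r.inj this
  exact Int.natCast_eq_zero.1 h'

end SapphireGroup

/-! ### Exactness over Klein bottle groups and along the tree -/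

section Klein

variable {k G : Type*} [CommRing k] [Group G] {x y : G}

open MonoidAlgebra

lemma of_klein (h : y * x * y = x) : of k G y * of k G x * of k G y = of k G x := by
  rw [← map_mul, ← map_mul, h]

/-- Exactness in degree one of the free resolution over a Klein bottle group
`⟨x, y ∣ y x y = x⟩`, where the row `(y - 1, 1 + y x)` consists of the Fox derivatives of the
relation. -/
lemma exists_eq_mul_of_klein_cycle (h : y * x * y = x) (hy : ∀ n : ℕ, y ^ n = 1 → n = 0)
    (hx : ∀ n : ℕ, (x ^ 2) ^ n ∈ Subgroup.zpowers y → n = 0) (hxy : Commute (x ^ 2) y)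
    {p q : MonoidAlgebra k G} (hpq : p * (of k G x - 1) + q * (of k G y - 1) = 0) :
    ∃ m, p = m * (of k G y - 1) ∧ q = m * (1 + of k G y * of k G x) := by
  have hk := of_klein (k := k) h
  obtain ⟨m, hm⟩ : ∃ m, p = m * (of k G y - 1) := by
    refine exists_eq_mul_of_mul_of_sub_one_eq hxy hx (y := -q * (1 - of k G y * of k G x)) ?_
    rw [map_pow]
    linear_combination (norm := noncomm_ring) hpq * (of k G x + 1) - q * hk
  refine ⟨m, hm, sub_eq_zero.1 (eq_zero_of_mul_of_sub_one_eq_zero hy ?_)⟩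
  subst hm
  linear_combination (norm := noncomm_ring) hpq - m * hk

/-- The relation between the Fox derivatives `x + 1` of `x²` and `y - 1` of `y x y` with respect to
`x` is generated by `(y - 1, y x - 1)`. -/
lemma exists_eq_mul_of_klein_syzygy (h : y * x * y = x) (hy : ∀ n : ℕ, y ^ n = 1 → n = 0)
    (hx : ∀ n : ℕ, (x ^ 2) ^ n ∈ Subgroup.zpowers y → n = 0) (hxy : Commute (x ^ 2) y)
    {p q : MonoidAlgebra k G} (hpq : p * (of k G x + 1) + q * (of k G y - 1) = 0) :
    ∃ m, p = m * (of k G y - 1) ∧ q = m * (of k G y * of k G x - 1) := by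
  have hk := of_klein (k := k) h
  obtain ⟨m, hm⟩ : ∃ m, p = m * (of k G y - 1) := by
    refine exists_eq_mul_of_mul_of_sub_one_eq hxy hx (y := q * (1 + of k G y * of k G x)) ?_
    rw [map_pow]
    linear_combination (norm := noncomm_ring) hpq * (of k G x - 1) - q * hk
  refine ⟨m, hm, sub_eq_zero.1 (eq_zero_of_mul_of_sub_one_eq_zero hy ?_)⟩
  subst hm
  linear_combination (norm := noncomm_ring) hpq - m * hk

end Klein

namespace SapphireGroup

open MonoidAlgebra

variable {r s t u : ℤ}

lemma b_pow_eq_one (hdet : (r * u - s * t) * (r * u - s * t) = 1) (n : ℕ)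
    (h : b r s t u ^ n = 1) : n = 0 := by
  have := (eq_zero_of_a_sq_zpow_mul_b_zpow_eq_one (i := 0) (j := n) hdet (by simpa using h)).2
  exact_mod_cast this

lemma z_pow_eq_one (hdet : (r * u - s * t) * (r * u - s * t) = 1) (n : ℕ)
    (h : z r s t u ^ n = 1) : n = 0 := by
  have := (eq_zero_of_c_sq_zpow_mul_z_zpow_eq_one (i := 0) (j := n) hdet (by simpa using h)).2
  exact_mod_cast this

lemma a_sq_pow_mem_zpowers_b (hdet : (r * u - s * t) * (r * u - s * t) = 1) (n : ℕ)
    (h : (a r s t u ^ 2) ^ n ∈ Subgroup.zpowers (b r s t u)) : n = 0 := by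
  obtain ⟨j, hj⟩ := h
  have := (eq_zero_of_a_sq_zpow_mul_b_zpow_eq_one (i := n) (j := -j) hdet
    (by rw [zpow_natCast, ← hj]; group)).1
  exact_mod_cast this

lemma c_sq_pow_mem_zpowers_z (hdet : (r * u - s * t) * (r * u - s * t) = 1) (n : ℕ)
    (h : (c r s t u ^ 2) ^ n ∈ Subgroup.zpowers (z r s t u)) : n = 0 := by
  obtain ⟨j, hj⟩ := h
  have := (eq_zero_of_c_sq_zpow_mul_z_zpow_eq_one (i := n) (j := -j) hdet
    (by rw [zpow_natCast, ← hj]; group)).1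
  exact_mod_cast this

/-- The algebraic form of the Bass–Serre graph being a tree: the quotient of the group by the torus
subgroup is the free product of the images of `a₁` and `a₂`, both of order two, so modulo the torus
a relation `p * (a₁ - 1) + q * (a₂ - 1) = 0` forces `q` to be a multiple of `a₂ + 1`. Since the
torus is generated by `a₂²` and `z`, this lifts to the group ring as stated. -/
lemma exists_eq_of_tree_cycle (hdet : (r * u - s * t) * (r * u - s * t) = 1)
    {p q m : MonoidAlgebra ℤ (SapphireGroup r s t u)}
    (h : p * (of ℤ _ (a r s t u) - 1) + q * (of ℤ _ (c r s t u) - 1) =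
      m * (of ℤ _ (b r s t u) - 1)) :
    ∃ m n, q = m * (of ℤ _ (c r s t u) + 1) + n * (of ℤ _ (z r s t u) - 1) := by
  have := torus_normal hdet
  let Q := SapphireGroup r s t u ⧸ torus r s t u
  let φ := mapDomainRingHom ℤ (QuotientGroup.mk' (torus r s t u))
  have hφ (g : SapphireGroup r s t u) : φ (of ℤ _ g) = of ℤ Q (QuotientGroup.mk g) := by
    simp [φ, Q]
  let α := of ℤ Q (QuotientGroup.mk (a r s t u))
  let γ := of ℤ Q (QuotientGroup.mk (c r s t u))
  have hγγ : (QuotientGroup.mk (c r s t u) * QuotientGroup.mk (c r s t u) : Q) = 1 := by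
    rw [← QuotientGroup.mk_mul, QuotientGroup.eq_one_iff, ← sq]
    exact Subgroup.subset_closure (.inl rfl)
  have hα : α * α = 1 := by
    rw [← map_mul, ← QuotientGroup.mk_mul, ← sq, (QuotientGroup.eq_one_iff _).2, map_one]
    simpa using a_sq_zpow_mul_b_zpow_mem_torus hdet 1 0
  have hγ : γ * γ = 1 := by rw [← map_mul, hγγ, map_one]
  have hb : φ (of ℤ _ (b r s t u)) = 1 := by
    rw [hφ, (QuotientGroup.eq_one_iff _).2, map_one]
    simpa using a_sq_zpow_mul_b_zpow_mem_torus hdet 0 1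
  have hpq : φ p * (α - 1) + φ q * (γ - 1) = 0 := by
    have := congrArg φ h
    rwa [map_add, map_mul, map_mul, map_mul, map_sub, map_sub, map_sub, map_one, hb, sub_self,
      mul_zero, hφ, hφ] at this
  -- Up to sign `φ p * (α - 1)` and `φ q * (γ - 1)` agree, so this element is negated by both
  -- involutions `α` and `γ`, hence fixed by `α * γ`, which has infinite order.
  have hzero : φ q * (γ - 1) = 0 := by
    refine eq_zero_of_mul_of_sub_one_eq_zero
      (v := (QuotientGroup.mk (a r s t u * c r s t u) : Q)) (fun n hn => ?_) ?_
    · rw [← QuotientGroup.mk_pow, QuotientGroup.eq_one_iff] at hn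
      exact eq_zero_of_a_mul_c_pow_mem_torus hn
    · rw [QuotientGroup.mk_mul, map_mul]
      change φ q * (γ - 1) * (α * γ - 1) = 0
      linear_combination (norm := noncomm_ring) hpq * (α + 1) * γ - φ p * hα * γ - φ q * hγ
  obtain ⟨y, hy⟩ := exists_eq_mul_of_add_one hγγ
    (QuotientGroup.lift (torus r s t u) (sign r s t u) fun g hg => torus_le_ker_sign hg)
    (by rw [QuotientGroup.lift_mk]; simp [sign]) (x := φ q)
    (by linear_combination (norm := noncomm_ring) hzero)
  obtain ⟨m, rfl⟩ : ∃ m, φ m = y := by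
    obtain ⟨f, hf⟩ := Finsupp.mapDomain_surjective (M := ℤ)
      (QuotientGroup.mk'_surjective (torus r s t u)) y.coeff
    exact ⟨ofCoeff f, MonoidAlgebra.ext hf⟩
  have hker : φ (q - m * (of ℤ _ (c r s t u) + 1)) = 0 := by
    rw [map_sub, map_mul, map_add, map_one, hφ, hy, sub_self]
  have hmem := mem_span_of_mapDomain_mk_eq_zero (congrArg coeff hker)
  rw [Set.image_pair, Ideal.mem_span_pair] at hmem
  obtain ⟨m', n, hmn⟩ := hmem
  refine ⟨m + m' * (of ℤ _ (c r s t u) - 1), n, ?_⟩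
  rw [map_pow] at hmn
  linear_combination (norm := noncomm_ring) -hmn

end SapphireGroup

/-! ### The free resolution over the sapphire group -/

namespace SapphireGroup

open MonoidAlgebra

variable {r s t u : ℤ}

/-- A Fox quotient `(g ^ n - 1) / (g - 1)` in the integral group ring. -/
noncomputable def foxQuotient {G : Type*} [Group G] (g : G) (n : ℤ) : MonoidAlgebra ℤ G :=
  (exists_mul_of_sub_one_eq_zpow g n).choose

lemma foxQuotient_mul {G : Type*} [Group G] (g : G) (n : ℤ) :
    foxQuotient g n * (of ℤ G g - 1) = of ℤ G (g ^ n) - 1 :=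
  (exists_mul_of_sub_one_eq_zpow g n).choose_spec.1

lemma augmentation_foxQuotient {G : Type*} [Group G] (g : G) (n : ℤ) :
    augmentation ℤ G (foxQuotient g n) = n := by
  exact (exists_mul_of_sub_one_eq_zpow g n).choose_spec.2

/-- The matrix of the differential from degree one to degree zero: generators `g` go to `g - 1`. -/
noncomputable def bd₁ (r s t u : ℤ) :
    Matrix (Fin 3) (Fin 1) (MonoidAlgebra ℤ (SapphireGroup r s t u)) :=
  !![of ℤ _ (a r s t u) - 1; of ℤ _ (b r s t u) - 1; of ℤ _ (c r s t u) - 1]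

/-- The Fox matrix of the presentation with the relations written as `b₁ a₁ b₁ = a₁`,
`a₂² = a₁ ^ (2 * r) * b₁ ^ s` and `z a₂ z = a₂`. -/
noncomputable def bd₂ (r s t u : ℤ) :
    Matrix (Fin 3) (Fin 3) (MonoidAlgebra ℤ (SapphireGroup r s t u)) :=
  !![of ℤ _ (b r s t u) - 1, 1 + of ℤ _ (b r s t u) * of ℤ _ (a r s t u), 0;
    -foxQuotient (a r s t u) (2 * r),
      -(of ℤ _ (a r s t u ^ (2 * r)) * foxQuotient (b r s t u) s), of ℤ _ (c r s t u) + 1;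
    (1 + of ℤ _ (z r s t u) * of ℤ _ (c r s t u)) * foxQuotient (a r s t u) (2 * t),
      (1 + of ℤ _ (z r s t u) * of ℤ _ (c r s t u)) *
        (of ℤ _ (a r s t u ^ (2 * t)) * foxQuotient (b r s t u) u),
      of ℤ _ (z r s t u) - 1]

lemma bd₂_zero_one :
    bd₂ r s t u 0 1 = 1 + of ℤ _ (b r s t u) * of ℤ _ (a r s t u) := rfl

lemma vecMul_bd₁ (v : Fin 3 → MonoidAlgebra ℤ (SapphireGroup r s t u)) :
    Matrix.vecMul v (bd₁ r s t u) = ![v 0 * (of ℤ _ (a r s t u) - 1) +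
      v 1 * (of ℤ _ (b r s t u) - 1) + v 2 * (of ℤ _ (c r s t u) - 1)] := by
  ext1 i
  rw [Subsingleton.elim i 0, Matrix.vecMul, dotProduct, Fin.sum_univ_three]
  rfl

lemma vecMul_bd₂ (v : Fin 3 → MonoidAlgebra ℤ (SapphireGroup r s t u)) :
    Matrix.vecMul v (bd₂ r s t u) =
      ![v 0 * bd₂ r s t u 0 0 + v 1 * bd₂ r s t u 1 0 + v 2 * bd₂ r s t u 2 0,
        v 0 * bd₂ r s t u 0 1 + v 1 * bd₂ r s t u 1 1 + v 2 * bd₂ r s t u 2 1,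
        v 1 * (of ℤ _ (c r s t u) + 1) + v 2 * (of ℤ _ (z r s t u) - 1)] := by
  ext1 i
  fin_cases i <;> rw [Matrix.vecMul, dotProduct, Fin.sum_univ_three]
  · rfl
  · rfl
  · change v 0 * 0 + _ + _ = _
    rw [mul_zero, zero_add]
    rfl

lemma bd₂_row_zero : bd₂ r s t u 0 0 * (of ℤ _ (a r s t u) - 1) +
    bd₂ r s t u 0 1 * (of ℤ _ (b r s t u) - 1) = 0 := by
  have hb := of_klein (k := ℤ) (b_a_b (r := r) (s := s) (t := t) (u := u))
  change (of ℤ _ (b r s t u) - 1) * (of ℤ _ (a r s t u) - 1) +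
    (1 + of ℤ _ (b r s t u) * of ℤ _ (a r s t u)) * (of ℤ _ (b r s t u) - 1) = 0
  linear_combination (norm := noncomm_ring) hb

lemma bd₂_row_one : bd₂ r s t u 1 0 * (of ℤ _ (a r s t u) - 1) +
    bd₂ r s t u 1 1 * (of ℤ _ (b r s t u) - 1) +
    (of ℤ _ (c r s t u) + 1) * (of ℤ _ (c r s t u) - 1) = 0 := by
  have hc := congrArg (of ℤ _) (c_sq (r := r) (s := s) (t := t) (u := u))
  rw [map_mul, map_pow] at hc
  have h₁ := foxQuotient_mul (a r s t u) (2 * r)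
  have h₂ := foxQuotient_mul (b r s t u) s
  change -foxQuotient (a r s t u) (2 * r) * (of ℤ _ (a r s t u) - 1) +
    -(of ℤ _ (a r s t u ^ (2 * r)) * foxQuotient (b r s t u) s) * (of ℤ _ (b r s t u) - 1) + _ = 0
  linear_combination (norm := noncomm_ring) hc - h₁ - of ℤ _ (a r s t u ^ (2 * r)) * h₂

lemma bd₂_row_two : bd₂ r s t u 2 0 * (of ℤ _ (a r s t u) - 1) +
    bd₂ r s t u 2 1 * (of ℤ _ (b r s t u) - 1) +
    (of ℤ _ (z r s t u) - 1) * (of ℤ _ (c r s t u) - 1) = 0 := by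
  have hz := of_klein (k := ℤ) (z_c_z (r := r) (s := s) (t := t) (u := u))
  have hzdef := congrArg (of ℤ _) (z.eq_def r s t u)
  rw [map_mul] at hzdef
  have h₁ := foxQuotient_mul (a r s t u) (2 * t)
  have h₂ := foxQuotient_mul (b r s t u) u
  change (1 + of ℤ _ (z r s t u) * of ℤ _ (c r s t u)) * foxQuotient (a r s t u) (2 * t) *
    (of ℤ _ (a r s t u) - 1) + (1 + of ℤ _ (z r s t u) * of ℤ _ (c r s t u)) *
      (of ℤ _ (a r s t u ^ (2 * t)) * foxQuotient (b r s t u) u) * (of ℤ _ (b r s t u) - 1) + _ = 0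
  linear_combination (norm := noncomm_ring)
    (1 + of ℤ _ (z r s t u) * of ℤ _ (c r s t u)) * h₁ +
    (1 + of ℤ _ (z r s t u) * of ℤ _ (c r s t u)) * of ℤ _ (a r s t u ^ (2 * t)) * h₂ -
    (1 + of ℤ _ (z r s t u) * of ℤ _ (c r s t u)) * hzdef + hz

lemma vecMul_bd₂_mul_bd₁ (v : Fin 3 → MonoidAlgebra ℤ (SapphireGroup r s t u)) :
    Matrix.vecMul (Matrix.vecMul v (bd₂ r s t u)) (bd₁ r s t u) = 0 := by
  rw [vecMul_bd₂, vecMul_bd₁]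
  ext1 i
  rw [Subsingleton.elim i 0]
  change (_ + _ + _) * _ + (_ + _ + _) * _ + (_ + _) * _ = (0 : MonoidAlgebra ℤ _)
  linear_combination (norm := noncomm_ring) v 0 * bd₂_row_zero (r := r) (s := s) (t := t) (u := u) +
    v 1 * bd₂_row_one (r := r) (s := s) (t := t) (u := u) +
    v 2 * bd₂_row_two (r := r) (s := s) (t := t) (u := u)

/-- Cycles of degree one without `a₂`-component come from the first Klein bottle relation. -/
lemma exists_eq_mul_of_cycle (hdet : (r * u - s * t) * (r * u - s * t) = 1)
    {p q : MonoidAlgebra ℤ (SapphireGroup r s t u)}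
    (h : p * (of ℤ _ (a r s t u) - 1) + q * (of ℤ _ (b r s t u) - 1) = 0) :
    ∃ l, p = l * bd₂ r s t u 0 0 ∧ q = l * bd₂ r s t u 0 1 :=
  exists_eq_mul_of_klein_cycle b_a_b (b_pow_eq_one hdet) (a_sq_pow_mem_zpowers_b hdet)
    commute_a_sq_b h

/-- Exactness in degree zero: the augmentation ideal is generated by the elements `g - 1`. -/
lemma bd₁_exact (v : Fin 1 → MonoidAlgebra ℤ (SapphireGroup r s t u))
    (hv : ∀ i, augmentation ℤ _ (v i) = 0) : ∃ w, Matrix.vecMul w (bd₁ r s t u) = v := by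
  have h := mem_span_of_augmentation_eq_zero closure_generators (hv 0)
  rw [Set.image_insert_eq, Set.image_pair, Ideal.mem_span_insert'] at h
  obtain ⟨p, hp⟩ := h
  obtain ⟨q, m, hqm⟩ := Ideal.mem_span_pair.1 hp
  refine ⟨![-p, q, m], ?_⟩
  rw [vecMul_bd₁]
  ext1 i
  rw [Subsingleton.elim i 0]
  change -p * _ + q * _ + m * _ = _
  linear_combination (norm := noncomm_ring) hqm

/-- Exactness in degree one. The tree argument removes the `a₂`-coordinate of a cycle, which leaves
a cycle for the first Klein bottle group. -/
lemma bd₂_exact (hdet : (r * u - s * t) * (r * u - s * t) = 1)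
    (v : Fin 3 → MonoidAlgebra ℤ (SapphireGroup r s t u))
    (hv : Matrix.vecMul v (bd₁ r s t u) = 0) : ∃ w, Matrix.vecMul w (bd₂ r s t u) = v := by
  have h : v 0 * (of ℤ _ (a r s t u) - 1) + v 1 * (of ℤ _ (b r s t u) - 1) +
      v 2 * (of ℤ _ (c r s t u) - 1) = 0 := by
    rw [vecMul_bd₁] at hv
    exact congrFun hv 0
  obtain ⟨m, n, hmn⟩ := exists_eq_of_tree_cycle hdet (p := v 0) (q := v 2) (m := -v 1)
    (by linear_combination (norm := noncomm_ring) h)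
  obtain ⟨l, hl₀, hl₁⟩ := exists_eq_mul_of_cycle hdet
    (p := v 0 - m * bd₂ r s t u 1 0 - n * bd₂ r s t u 2 0)
    (q := v 1 - m * bd₂ r s t u 1 1 - n * bd₂ r s t u 2 1) (by
      rw [hmn] at h
      linear_combination (norm := noncomm_ring) h -
        m * bd₂_row_one (r := r) (s := s) (t := t) (u := u) -
        n * bd₂_row_two (r := r) (s := s) (t := t) (u := u))
  refine ⟨![l, m, n], ?_⟩
  rw [vecMul_bd₂]
  ext1 i
  fin_cases i
  · change l * _ + m * _ + n * _ = v 0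
    linear_combination (norm := noncomm_ring) -hl₀
  · change l * _ + m * _ + n * _ = v 1
    linear_combination (norm := noncomm_ring) -hl₁
  · exact hmn.symm

/-- The three-cell: its last two boundary coordinates are the syzygy of the second Klein bottle
group, and exactness for the first one supplies the remaining coordinate. -/
lemma exists_syzygy (hdet : (r * u - s * t) * (r * u - s * t) = 1) :
    ∃ κ, Matrix.vecMul ![κ, of ℤ _ (z r s t u) - 1,
      of ℤ _ (z r s t u) * of ℤ _ (c r s t u) - 1] (bd₂ r s t u) = 0 := by
  have hz := of_klein (k := ℤ) (z_c_z (r := r) (s := s) (t := t) (u := u))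
  have hc : (of ℤ _ (z r s t u) - 1) * (of ℤ _ (c r s t u) + 1) +
      (of ℤ _ (z r s t u) * of ℤ _ (c r s t u) - 1) * (of ℤ _ (z r s t u) - 1) = 0 := by
    linear_combination (norm := noncomm_ring) hz
  obtain ⟨l, hl₀, hl₁⟩ := exists_eq_mul_of_cycle hdet
    (p := (of ℤ _ (z r s t u) - 1) * bd₂ r s t u 1 0 +
      (of ℤ _ (z r s t u) * of ℤ _ (c r s t u) - 1) * bd₂ r s t u 2 0)
    (q := (of ℤ _ (z r s t u) - 1) * bd₂ r s t u 1 1 +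
      (of ℤ _ (z r s t u) * of ℤ _ (c r s t u) - 1) * bd₂ r s t u 2 1) (by
      linear_combination (norm := noncomm_ring)
        (of ℤ _ (z r s t u) - 1) * bd₂_row_one (r := r) (s := s) (t := t) (u := u) +
        (of ℤ _ (z r s t u) * of ℤ _ (c r s t u) - 1) *
          bd₂_row_two (r := r) (s := s) (t := t) (u := u) - hc * (of ℤ _ (c r s t u) - 1))
  refine ⟨-l, ?_⟩
  rw [vecMul_bd₂]
  ext1 i
  fin_cases i
  · change -l * _ + (of ℤ _ (z r s t u) - 1) * bd₂ r s t u 1 0 +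
      (of ℤ _ (z r s t u) * of ℤ _ (c r s t u) - 1) * bd₂ r s t u 2 0 = 0
    linear_combination (norm := noncomm_ring) hl₀
  · change -l * _ + (of ℤ _ (z r s t u) - 1) * bd₂ r s t u 1 1 +
      (of ℤ _ (z r s t u) * of ℤ _ (c r s t u) - 1) * bd₂ r s t u 2 1 = 0
    linear_combination (norm := noncomm_ring) hl₁
  · exact hc

/-- The matrix of the differential from degree three to degree two. -/
noncomputable def bd₃ (hdet : (r * u - s * t) * (r * u - s * t) = 1) :
    Matrix (Fin 1) (Fin 3) (MonoidAlgebra ℤ (SapphireGroup r s t u)) :=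
  Matrix.of fun _ => ![(exists_syzygy hdet).choose, of ℤ _ (z r s t u) - 1,
    of ℤ _ (z r s t u) * of ℤ _ (c r s t u) - 1]

lemma bd₃_zero_one (hdet : (r * u - s * t) * (r * u - s * t) = 1) :
    bd₃ hdet 0 1 = of ℤ _ (z r s t u) - 1 := rfl

lemma bd₃_zero_two (hdet : (r * u - s * t) * (r * u - s * t) = 1) :
    bd₃ hdet 0 2 = of ℤ _ (z r s t u) * of ℤ _ (c r s t u) - 1 := rfl

lemma vecMul_bd₃ (hdet : (r * u - s * t) * (r * u - s * t) = 1)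
    (v : Fin 1 → MonoidAlgebra ℤ (SapphireGroup r s t u)) :
    Matrix.vecMul v (bd₃ hdet) = v 0 • bd₃ hdet 0 := by
  ext1 i
  rw [Matrix.vecMul, dotProduct, Fin.sum_univ_one]
  rfl

lemma vecMul_bd₃_row (hdet : (r * u - s * t) * (r * u - s * t) = 1) :
    Matrix.vecMul (bd₃ hdet 0) (bd₂ r s t u) = 0 :=
  (exists_syzygy hdet).choose_spec

/-- Exactness in degree two. The last two coordinates of a cycle are a multiple of the syzygy of the
second Klein bottle group, and they determine the first one because `b₁ - 1` is not a right zero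
divisor. -/
lemma bd₃_exact (hdet : (r * u - s * t) * (r * u - s * t) = 1)
    (v : Fin 3 → MonoidAlgebra ℤ (SapphireGroup r s t u))
    (hv : Matrix.vecMul v (bd₂ r s t u) = 0) : ∃ w, Matrix.vecMul w (bd₃ hdet) = v := by
  have hrow := vecMul_bd₃_row hdet
  rw [vecMul_bd₂] at hv hrow
  obtain ⟨m, hm₁, hm₂⟩ := exists_eq_mul_of_klein_syzygy z_c_z (z_pow_eq_one hdet)
    (c_sq_pow_mem_zpowers_z hdet) commute_c_sq_z (congrFun hv 2)
  have h₀ : v 0 - m * bd₃ hdet 0 0 = 0 := by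
    refine eq_zero_of_mul_of_sub_one_eq_zero (b_pow_eq_one hdet) ?_
    have e₁ : v 0 * (of ℤ _ (b r s t u) - 1) + v 1 * bd₂ r s t u 1 0 + v 2 * bd₂ r s t u 2 0 = 0 :=
      congrFun hv 0
    have e₂ : bd₃ hdet 0 0 * (of ℤ _ (b r s t u) - 1) +
        (of ℤ _ (z r s t u) - 1) * bd₂ r s t u 1 0 +
        (of ℤ _ (z r s t u) * of ℤ _ (c r s t u) - 1) * bd₂ r s t u 2 0 = 0 := congrFun hrow 0
    rw [hm₁, hm₂] at e₁
    linear_combination (norm := noncomm_ring) e₁ - m * e₂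
  refine ⟨![m], ?_⟩
  rw [vecMul_bd₃]
  ext1 i
  fin_cases i
  · exact (sub_eq_zero.1 h₀).symm
  · exact hm₁.symm
  · exact hm₂.symm

lemma eq_zero_of_vecMul_bd₃ (hdet : (r * u - s * t) * (r * u - s * t) = 1)
    (v : Fin 1 → MonoidAlgebra ℤ (SapphireGroup r s t u))
    (hv : Matrix.vecMul v (bd₃ hdet) = 0) : v = 0 := by
  rw [vecMul_bd₃] at hv
  ext1 i
  rw [Subsingleton.elim i 0]
  exact eq_zero_of_mul_of_sub_one_eq_zero (z_pow_eq_one hdet) (congrFun hv 1)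

lemma vecMul_bd₃_mul_bd₂ (hdet : (r * u - s * t) * (r * u - s * t) = 1)
    (v : Fin 1 → MonoidAlgebra ℤ (SapphireGroup r s t u)) :
    Matrix.vecMul (Matrix.vecMul v (bd₃ hdet)) (bd₂ r s t u) = 0 := by
  rw [vecMul_bd₃, Matrix.smul_vecMul, vecMul_bd₃_row, smul_zero]

/-- The ranks of the free resolution over the sapphire group. -/
def resolutionRank : ℕ → ℕ
  | 0 => 1
  | 1 => 3
  | 2 => 3
  | 3 => 1
  | _ + 4 => 0

/-- The differentials of the free resolution over the sapphire group. -/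
noncomputable def resolutionBd (hdet : (r * u - s * t) * (r * u - s * t) = 1) : (n : ℕ) →
    Matrix (Fin (resolutionRank (n + 1))) (Fin (resolutionRank n))
      (MonoidAlgebra ℤ (SapphireGroup r s t u))
  | 0 => bd₁ r s t u
  | 1 => bd₂ r s t u
  | 2 => bd₃ hdet
  | _ + 3 => 0

/-- The free resolution of length three over the sapphire group. -/
noncomputable def resolution (hdet : (r * u - s * t) * (r * u - s * t) = 1) :
    MatrixResolution ℤ (SapphireGroup r s t u) where
  rank := resolutionRank
  bd := resolutionBd hdet
  rank_zero := rfl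
  bd_mul_bd
    | 0 => Matrix.ext_of_single_vecMul fun i => by
      rw [← Matrix.vecMul_vecMul, Matrix.vecMul_zero]
      exact vecMul_bd₂_mul_bd₁ _
    | 1 => Matrix.ext_of_single_vecMul fun i => by
      rw [← Matrix.vecMul_vecMul, Matrix.vecMul_zero]
      exact vecMul_bd₃_mul_bd₂ hdet _
    | _ + 2 => Matrix.zero_mul _
  augmentation_bd i j := by
    change augmentation ℤ _ (bd₁ r s t u i j) = 0
    change Fin 3 at i
    change Fin 1 at j
    fin_cases i <;> fin_cases j <;> simp [bd₁]
  exact_zero := bd₁_exact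
  exact_succ
    | 0 => bd₂_exact hdet
    | 1 => bd₃_exact hdet
    | 2 => fun v hv => ⟨0, by
      rw [Matrix.zero_vecMul]
      exact (eq_zero_of_vecMul_bd₃ hdet v hv).symm⟩
    | _ + 3 => fun _ _ => ⟨0, funext fun i => i.elim0⟩

end SapphireGroup

/-! ### Cohomology of the sapphire group -/

namespace SapphireGroup

open MonoidAlgebra

variable {r s t u : ℤ} (hdet : (r * u - s * t) * (r * u - s * t) = 1)

lemma augmentation_of {G : Type*} [Group G] (g : G) : augmentation ℤ G (of ℤ G g) = 1 :=
  augmentation_single g 1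

/-- The augmented Fox matrix is the coboundary from degree one to degree two. -/
lemma coboundary_one_mulVec (w : Fin 3 → ℤ) :
    ((resolution hdet).coboundary 1).mulVec w =
      (![2 * w 1, -(2 * r) * w 0 - s * w 1 + 2 * w 2, 4 * t * w 0 + 2 * u * w 1] : Fin 3 → ℤ) := by
  have h : (resolution hdet).coboundary 1 =
      (!![0, 2, 0; -(2 * r), -s, 2; 4 * t, 2 * u, 0] : Matrix (Fin 3) (Fin 3) ℤ) := by
    change (bd₂ r s t u).map (augmentation ℤ _) = _
    ext i j
    fin_cases i <;> fin_cases j <;>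
      simp [bd₂, augmentation_foxQuotient, -of_apply, augmentation_of]
    all_goals ring
  rw [h]
  change Matrix.mulVec (!![0, 2, 0; -(2 * r), -s, 2; 4 * t, 2 * u, 0] : Matrix (Fin 3) (Fin 3) ℤ)
    w = _
  ext i
  rw [Matrix.mulVec_eq_sum, Fin.sum_univ_three]
  fin_cases i <;> simp <;> ring

/-- All boundary coefficients of the three-cell have augmentation zero, which is why the third
cohomology is infinite cyclic. -/
lemma augmentation_bd₃ (i : Fin 1) (j : Fin 3) : augmentation ℤ _ (bd₃ hdet i j) = 0 := by
  rw [Subsingleton.elim i 0]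
  have h₁ : augmentation ℤ _ (bd₃ hdet 0 1) = 0 := by
    rw [bd₃_zero_one, map_sub, augmentation_of, map_one, sub_self]
  have h₂ : augmentation ℤ _ (bd₃ hdet 0 2) = 0 := by
    rw [bd₃_zero_two, map_sub, map_mul, augmentation_of, augmentation_of, map_one, one_mul,
      sub_self]
  -- The entry not given explicitly is read off from the composite with the Fox matrix, whose
  -- relevant entry has augmentation `2`.
  have h₀ : augmentation ℤ _ (bd₃ hdet 0 0) = 0 := by
    have h : bd₃ hdet 0 0 * bd₂ r s t u 0 1 + bd₃ hdet 0 1 * bd₂ r s t u 1 1 +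
        bd₃ hdet 0 2 * bd₂ r s t u 2 1 = 0 :=
      congrFun ((vecMul_bd₂ (bd₃ hdet 0)).symm.trans (vecMul_bd₃_row hdet)) 1
    have h' : augmentation ℤ _ (bd₂ r s t u 0 1) = 2 := by
      rw [bd₂_zero_one, map_add, map_mul, augmentation_of, augmentation_of, map_one]
      rfl
    have := congrArg (augmentation ℤ _) h
    rw [map_add, map_add, map_mul, map_mul, map_mul, h₁, h₂, h', map_zero] at this
    lia
  fin_cases j
  exacts [h₀, h₁, h₂]

lemma coboundary_two_mulVec (w : Fin 3 → ℤ) :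
    ((resolution hdet).coboundary 2).mulVec w = 0 := by
  have : (resolution hdet).coboundary 2 = 0 := by
    ext i j
    exact augmentation_bd₃ hdet i j
  rw [this]
  exact Matrix.zero_mulVec w

lemma subsingleton_sapphireCohomology (n : ℕ)
    (h : ∀ v, ((resolution hdet).coboundary (n + 1)).mulVec v = 0 →
      ∃ w, ((resolution hdet).coboundary n).mulVec w = v) :
    Subsingleton (SapphireCohomology r s t u (n + 1)) := by
  obtain ⟨e⟩ := (resolution hdet).nonempty_groupCohomology_equiv n (Q := PUnit) 0
    (fun _ => ⟨0, Matrix.mulVec_zero _, rfl⟩) fun v hv => ⟨fun _ => h v hv, fun _ => rfl⟩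
  exact e.toEquiv.subsingleton

/-- The second cohomology is `ℤ³` modulo the columns of the augmented Fox matrix. -/
lemma nonempty_sapphireCohomology_two_equiv
    (hdet : (r * u - s * t) * (r * u - s * t) = 1) {Q : Type*} [AddCommGroup Q]
    (φ : (Fin 3 → ℤ) →+ Q) (hφ : Function.Surjective φ)
    (hker : ∀ v, φ v = 0 ↔ ∃ x y w : ℤ,
      2 * y = v 0 ∧ -(2 * r) * x - s * y + 2 * w = v 1 ∧ 4 * t * x + 2 * u * y = v 2) :
    Nonempty (SapphireCohomology r s t u 2 ≃+ Q) := by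
  obtain ⟨e⟩ := (resolution hdet).nonempty_groupCohomology_equiv 1 φ.toIntLinearMap
    (fun q => (hφ q).imp fun v hv => ⟨coboundary_two_mulVec hdet v, hv⟩) fun v _ => by
      refine (hker v).trans ⟨?_, ?_⟩
      · rintro ⟨x, y, w, h₀, h₁, h₂⟩
        refine ⟨(![x, y, w] : Fin 3 → ℤ), (coboundary_one_mulVec hdet _).trans ?_⟩
        change (_ : Fin 3 → ℤ) = v
        ext i
        fin_cases i
        exacts [h₀, h₁, h₂]
      · rintro ⟨w, hw⟩
        rw [coboundary_one_mulVec hdet w] at hw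
        exact ⟨w (0 : Fin 3), w (1 : Fin 3), w (2 : Fin 3), congrFun hw (0 : Fin 3),
          congrFun hw (1 : Fin 3), congrFun hw (2 : Fin 3)⟩
  exact ⟨e.toAddEquiv⟩

end SapphireGroup

open SapphireGroup

theorem mainTheorem6 (r s t u : ℤ)
    (hdet : r * u - s * t = 1 ∨ r * u - s * t = -1)
    (hne : r * s * t * u ≠ 0) :
    Nonempty (SapphireCohomology r s t u 0 ≃+ ℤ) ∧
    Subsingleton (SapphireCohomology r s t u 1) ∧
    (Even s →
      Nonempty (SapphireCohomology r s t u 2 ≃+ ZMod (4 * t).natAbs × ZMod 2 × ZMod 2)) ∧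
    (Odd s →
      Nonempty (SapphireCohomology r s t u 2 ≃+ ZMod (4 * t).natAbs × ZMod 4)) ∧
    Nonempty (SapphireCohomology r s t u 3 ≃+ ℤ) ∧
    ∀ n : ℕ, 4 ≤ n → Subsingleton (SapphireCohomology r s t u n) := by
  have ht : t ≠ 0 := by
    rintro rfl
    simp at hne
  have hdet' : (r * u - s * t) * (r * u - s * t) = 1 := by
    rcases hdet with h | h <;> rw [h] <;> norm_num
  have hcast (x : ℤ) : (x : ZMod (4 * t).natAbs) = 0 ↔ 4 * t ∣ x := by
    rw [ZMod.intCast_zmod_eq_zero_iff_dvd, Int.natAbs_dvd]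
  -- In the quotient of `ℤ³` by the columns `(0, -2r, 4t)`, `(2, -s, 2u)`, `(0, 2, 0)` of the
  -- augmented Fox matrix, the coordinate `v 2 - u * v 0` is well defined modulo `4t`.
  let ev (i : Fin 3) : (Fin 3 → ℤ) →+ ℤ := Pi.evalAddMonoidHom (fun _ => ℤ) i
  let φ₀ : (Fin 3 → ℤ) →+ ZMod (4 * t).natAbs :=
    (Int.castAddHom _).comp (ev 2 - (AddMonoidHom.mulLeft u).comp (ev 0))
  have hφ₀ (v : Fin 3 → ℤ) : φ₀ v = ((v 2 - u * v 0 : ℤ) : ZMod (4 * t).natAbs) := rfl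
  refine ⟨?_, ?_, fun hs => ?_, fun hs => ?_, ?_, fun n hn => ?_⟩
  · exact ⟨(groupCohomology.H0IsoOfIsTrivial
      (Rep.trivial ℤ (SapphireGroup r s t u) ℤ)).toLinearEquiv.toAddEquiv⟩
  · refine subsingleton_sapphireCohomology hdet' 0 fun v hv => ⟨0, ?_⟩
    rw [coboundary_one_mulVec hdet' v] at hv
    have h₀ : 2 * v (1 : Fin 3) = 0 := congrFun hv (0 : Fin 3)
    have h₁ : -(2 * r) * v (0 : Fin 3) - s * v (1 : Fin 3) + 2 * v (2 : Fin 3) = 0 :=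
      congrFun hv (1 : Fin 3)
    have h₂ : 4 * t * v (0 : Fin 3) + 2 * u * v (1 : Fin 3) = 0 := congrFun hv (2 : Fin 3)
    have e₁ : v (1 : Fin 3) = 0 := by lia
    have e₀ : v (0 : Fin 3) = 0 := by
      rw [e₁, mul_zero, add_zero] at h₂
      simpa [ht] using h₂
    have e₂ : v (2 : Fin 3) = 0 := by
      rw [e₁, e₀] at h₁
      lia
    rw [Matrix.mulVec_zero]
    change (0 : Fin 3 → ℤ) = v
    ext i
    fin_cases i
    exacts [e₀.symm, e₁.symm, e₂.symm]
  · obtain ⟨s', rfl⟩ := hs.two_dvd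
    let φ : (Fin 3 → ℤ) →+ ZMod (4 * t).natAbs × ZMod 2 × ZMod 2 :=
      φ₀.prod (((Int.castAddHom _).comp (ev 0)).prod
        ((Int.castAddHom _).comp (ev 1)))
    refine nonempty_sapphireCohomology_two_equiv hdet' φ ?_ fun v => ?_
    · rintro ⟨x, y, z⟩
      obtain ⟨i, rfl⟩ := ZMod.intCast_surjective x
      obtain ⟨j, rfl⟩ := ZMod.intCast_surjective y
      obtain ⟨l, rfl⟩ := ZMod.intCast_surjective z
      refine ⟨![j, l, i + u * j], Prod.ext ?_ rfl⟩
      change ((i + u * j - u * j : ℤ) : ZMod (4 * t).natAbs) = i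
      rw [add_sub_cancel_right]
    · have : φ v = 0 ↔ φ₀ v = 0 ∧ ((v 0 : ℤ) : ZMod 2) = 0 ∧ ((v 1 : ℤ) : ZMod 2) = 0 := by
        rw [Prod.ext_iff, Prod.ext_iff]; rfl
      rw [this, hφ₀, hcast, ZMod.intCast_zmod_eq_zero_iff_dvd, ZMod.intCast_zmod_eq_zero_iff_dvd]
      constructor
      · rintro ⟨⟨x, hx⟩, ⟨y, hy⟩, ⟨w, hw⟩⟩
        refine ⟨x, y, w + r * x + s' * y, hy.symm, ?_, ?_⟩
        · rw [hw]; push_cast; ring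
        · rw [hy] at hx; push_cast at hx; linear_combination -hx
      · rintro ⟨x, y, w, h₀, h₁, h₂⟩
        refine ⟨⟨x, ?_⟩, ⟨y, h₀.symm⟩, ⟨w - r * x - s' * y, ?_⟩⟩
        · linear_combination u * h₀ - h₂
        · push_cast; linear_combination -h₁
  · obtain ⟨s', rfl⟩ := hs
    -- The column `(2, -s, 2u)` has `v 0 + 2 * v 1 = 2 - 2s`, a multiple of `4` for odd `s`.
    let φ : (Fin 3 → ℤ) →+ ZMod (4 * t).natAbs × ZMod 4 :=
      φ₀.prod ((Int.castAddHom _).comp (ev 0 +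
        (AddMonoidHom.mulLeft 2).comp (ev 1)))
    have hφ (v : Fin 3 → ℤ) : φ v = (φ₀ v, ((v 0 + 2 * v 1 : ℤ) : ZMod 4)) := rfl
    refine nonempty_sapphireCohomology_two_equiv hdet' φ ?_ fun v => ?_
    · rintro ⟨x, y⟩
      obtain ⟨i, rfl⟩ := ZMod.intCast_surjective x
      obtain ⟨j, rfl⟩ := ZMod.intCast_surjective y
      refine ⟨![j, 0, i + u * j], Prod.ext ?_ ?_⟩
      · change ((i + u * j - u * j : ℤ) : ZMod (4 * t).natAbs) = i
        rw [add_sub_cancel_right]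
      · change ((j + 2 * 0 : ℤ) : ZMod 4) = j
        rw [mul_zero, add_zero]
    · rw [hφ, Prod.mk_eq_zero, hφ₀, hcast, ZMod.intCast_zmod_eq_zero_iff_dvd]
      constructor
      · rintro ⟨⟨x, hx⟩, ⟨l, hl⟩⟩
        push_cast at hl
        refine ⟨x, 2 * l - v 1, r * x + s' * (2 * l - v 1) + l, ?_, ?_, ?_⟩
        · linear_combination -hl
        · ring
        · linear_combination -hx - u * hl
      · rintro ⟨x, y, w, h₀, h₁, h₂⟩
        refine ⟨⟨x, ?_⟩, ⟨w - r * x - s' * y, ?_⟩⟩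
        · linear_combination u * h₀ - h₂
        · push_cast; linear_combination -h₀ - 2 * h₁
  · obtain ⟨e⟩ := (resolution hdet').nonempty_groupCohomology_equiv 2
      (LinearMap.proj (R := ℤ) (φ := fun _ : Fin 1 => ℤ) 0)
      (fun q => ⟨fun _ => q, funext fun i => i.elim0, rfl⟩) fun v _ => by
        refine ⟨fun hv => ⟨0, ?_⟩, ?_⟩
        · rw [Matrix.mulVec_zero]
          refine funext fun i : Fin 1 => ?_
          rw [Subsingleton.elim i 0]
          exact hv.symm
        · rintro ⟨w, rfl⟩
          rw [coboundary_two_mulVec hdet' w]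
          rfl
    exact ⟨e.toAddEquiv⟩
  · obtain ⟨m, rfl⟩ := Nat.exists_eq_add_of_le' hn
    exact subsingleton_sapphireCohomology hdet' (m + 3) fun v _ =>
      ⟨0, funext fun i => i.elim0⟩
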